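/- A meromorphic map is a meromorphic function $f:\mathbb C\to\mathbb C\cup\{\infty\}$. Its Fatou set is the set of $z\in\mathbb C$ having a neighbourhood on which all iterates $f^n$ are defined (no orbit meets a pole) and form a normal family with respect to the spherical metric; its Julia set $J(f)$ is the complement in $\mathbb C$ of the Fatou set. The map $f$ is in class $\mathcal B$ if the set of (finite) singularities of $f^{-1}$, i.e. of points $w\in\mathbb C$ having no neighbourhood over which $f:\mathbb C\setminus f^{-1}(\infty)\to\mathbb C$ is a covering, is bounded. A logarithmic tract of $f$ is an unbounded domain $T\subset\mathbb C$ with piecewise smooth boundary and unbounded complement such that $f$ is finite and continuous on $\overline T$ and, for some $R_0>0$, $|f(z)|>R_0$ for $z\in T$, $|f(z)|=R_0$ for $z\in\partial T$, and $f:T\to\{w\in\mathbb C:|w|>R_0\}$ is a holomorphic universal covering. A conformal expanding Cantor repeller contained in $J(f)$ is a Cantor set $X\subset J(f)$ (nonempty, compact, perfect, totally disconnected), containing no pole of $f$, with $f(X)=X$ and such that for some integer $k>0$ one has $|(f^k)'(z)|>1$ for all $z\in X$. The hyperbolic dimension of $J(f)$ is the supremum of the Hausdorff dimensions $\dim_H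 X$ of all such $X$. **Theorem.** Let $f$ be a meromorphic map with a logarithmic tract. Then 1. there is a conformal expanding Cantor repeller $X\subset J(f)$ with $\dim_H X>1$; 2. the hyperbolic dimension of $J(f)$ is greater than $1$; 3. the set of all $z\in J(f)$ whose forward orbit $(f^n(z))_{n\ge 0}$ is defined for all $n$ and bounded in $\mathbb C$ has Hausdorff dimension greater than $1$. Moreover, every transcendental meromorphic map with finitely many poles (in particular every transcendental entire map) in class $\mathcal B$ has a logarithmic tract, so that 1–3 hold for it. -/

import Mathlib

open Set Filter Topology

noncomputable section

namespace MeromorphicDynamics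

/-! A meromorphic map `ℂ → ℂ ∪ {∞}` is represented by `f : ℂ → ℂ` with `MeromorphicNFOn f univ`:
`f` is analytic at every point that is not a pole, and its (conventional) value at a pole is `0`.
The points where the map takes the value `∞` are recorded by `poles f`. -/

/-- The set of poles of `f`, that is, the points where the meromorphic map takes the value `∞`. -/
def poles (f : ℂ → ℂ) : Set ℂ := {z | meromorphicOrderAt f z < 0}

/-- `f` is transcendental: it is not (the restriction of) a rational function. -/
def IsTranscendental (f : ℂ → ℂ) : Prop :=
  ¬ ∃ p q : Polynomial ℂ, q ≠ 0 ∧ ∀ z, q.eval z ≠ 0 → f z = p.eval z / q.eval z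

/-- The (finite) singularities of `f⁻¹`: the points `w ∈ ℂ` having no neighbourhood over which
`f : ℂ ∖ poles → ℂ` is a covering, i.e. over which not all branches of the inverse are defined.
For nonconstant meromorphic `f` this is the closure of the set of finite critical and
asymptotic values. -/
def singularitiesOfInverse (f : ℂ → ℂ) : Set ℂ :=
  {w | ¬ IsEvenlyCovered (fun z : ((poles f)ᶜ : Set ℂ) => f z) w
        ((fun z : ((poles f)ᶜ : Set ℂ) => f z) ⁻¹' {w})}

/-- The Eremenko–Lyubich class: the set of singularities of `f⁻¹` is bounded. -/
def IsClassB (f : ℂ → ℂ) : Prop := Bornology.IsBounded (singularitiesOfInverse f)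

/-! ### Logarithmic tracts -/

/-- The boundary of `T` is piecewise smooth: it is a locally finite union of regular simple
`C¹` arcs, any two of which meet at most in common endpoints. -/
def HasPiecewiseSmoothBoundary (T : Set ℂ) : Prop :=
  ∃ (ι : Type) (γ : ι → ℝ → ℂ),
    (∀ i, ContDiffOn ℝ 1 (γ i) (Icc 0 1) ∧ InjOn (γ i) (Icc 0 1) ∧
      ∀ t ∈ Icc (0 : ℝ) 1, derivWithin (γ i) (Icc 0 1) t ≠ 0) ∧
    (∀ i j, i ≠ j → (γ i '' Icc 0 1) ∩ (γ j '' Icc 0 1) ⊆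
      {γ i 0, γ i 1} ∩ {γ j 0, γ j 1}) ∧
    LocallyFinite (fun i => γ i '' Icc (0 : ℝ) 1) ∧
    (⋃ i, γ i '' Icc (0 : ℝ) 1) = frontier T

/-- `T` is a logarithmic tract for `f`: an unbounded domain with piecewise smooth boundary and
unbounded complement, such that `f` is continuous on the closure of `T` and for some `R₀ > 0`
one has `|f| > R₀` on `T`, `|f| = R₀` on `∂T`, and `f : T → {|w| > R₀}` is a holomorphic
universal covering. -/
structure IsLogarithmicTract (f : ℂ → ℂ) (T : Set ℂ) : Prop where
  isOpen : IsOpen T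
  isConnected : IsConnected T
  unbounded : ¬ Bornology.IsBounded T
  compl_unbounded : ¬ Bornology.IsBounded Tᶜ
  piecewiseSmooth : HasPiecewiseSmoothBoundary T
  continuousOn : ContinuousOn f (closure T)
  exists_radius : ∃ R₀ : ℝ, 0 < R₀ ∧
    (∀ z ∈ frontier T, ‖f z‖ = R₀) ∧
    DifferentiableOn ℂ f T ∧
    SimplyConnectedSpace T ∧
    ∃ h : MapsTo f T {w | R₀ < ‖w‖}, IsCoveringMap (h.restrict f T {w | R₀ < ‖w‖})

/-- `f` has a logarithmic tract. -/
def HasLogarithmicTract (f : ℂ → ℂ) : Prop := ∃ T, IsLogarithmicTract f T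

/-! ### The Julia set -/

/-- The chordal distance on the Riemann sphere `OnePoint ℂ`. -/
def chordalDist (p q : OnePoint ℂ) : ℝ :=
  p.elim
    (q.elim 0 fun w => 2 / √(1 + ‖w‖ ^ 2))
    (fun z => q.elim (2 / √(1 + ‖z‖ ^ 2))
      fun w => 2 * ‖z - w‖ / (√(1 + ‖z‖ ^ 2) * √(1 + ‖w‖ ^ 2)))

/-- A sequence of finite-valued functions `g k` converges to `h : ℂ → ℂ ∪ {∞}` locally uniformly
on the open set `U` with respect to the chordal distance. -/
def SphericallyTendstoLocallyUniformlyOn (g : ℕ → ℂ → ℂ) (h : ℂ → OnePoint ℂ) (U : Set ℂ) : Prop :=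
  ∀ K ⊆ U, IsCompact K → ∀ ε > 0, ∃ N, ∀ k ≥ N, ∀ z ∈ K,
    chordalDist (g k z : OnePoint ℂ) (h z) < ε

/-- A family of functions is normal on `U` if every sequence of members of the family has a
subsequence that converges locally uniformly on `U` in the chordal distance. -/
def IsNormalFamilyOn (F : Set (ℂ → ℂ)) (U : Set ℂ) : Prop :=
  ∀ g : ℕ → ℂ → ℂ, (∀ n, g n ∈ F) → ∃ φ : ℕ → ℕ, StrictMono φ ∧
    ∃ h : ℂ → OnePoint ℂ, SphericallyTendstoLocallyUniformlyOn (fun k => g (φ k)) h U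

/-- All iterates of the meromorphic map are defined at `z`: the forward orbit of `z` contains
no pole. -/
def AllIteratesDefinedAt (f : ℂ → ℂ) (z : ℂ) : Prop := ∀ n : ℕ, f^[n] z ∉ poles f

/-- The Fatou set (in `ℂ`): the points having a neighbourhood in which all iterates are defined
and form a normal family. -/
def fatouSet (f : ℂ → ℂ) : Set ℂ :=
  {z | ∃ U : Set ℂ, IsOpen U ∧ z ∈ U ∧ (∀ w ∈ U, AllIteratesDefinedAt f w) ∧
    IsNormalFamilyOn (range fun n : ℕ => f^[n]) U}

/-- The Julia set (its part in `ℂ`): the complement of the Fatou set. -/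
def juliaSet (f : ℂ → ℂ) : Set ℂ := (fatouSet f)ᶜ

/-! ### Repellers and dimensions -/

/-- A Cantor set in the plane: nonempty, compact, without isolated points, totally disconnected. -/
structure IsCantorSet (X : Set ℂ) : Prop where
  nonempty : X.Nonempty
  isCompact : IsCompact X
  preperfect : Preperfect X
  totallyDisconnected : IsTotallyDisconnected X

/-- A conformal expanding Cantor repeller of `f` contained in `J(f)`: a compact invariant Cantor
set `X ⊆ J(f)` (containing no pole) such that `|(f^k)'| > 1` on `X` for some `k > 0`. -/
structure IsExpandingCantorRepeller (f : ℂ → ℂ) (X : Set ℂ) : Prop where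
  isCantorSet : IsCantorSet X
  subset_juliaSet : X ⊆ juliaSet f
  disjoint_poles : Disjoint X (poles f)
  invariant : f '' X = X
  expanding : ∃ k : ℕ, 0 < k ∧ ∀ z ∈ X, 1 < ‖deriv (f^[k]) z‖

/-- The hyperbolic dimension of `J(f)`: the supremum of the Hausdorff dimensions of all conformal
expanding Cantor repellers contained in `J(f)`. -/
def hyperbolicDimension (f : ℂ → ℂ) : ENNReal :=
  ⨆ (X : Set ℂ) (_ : IsExpandingCantorRepeller f X), dimH X

/-- The points of `J(f)` whose (infinite) forward orbit is defined and bounded in `ℂ`. -/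
def boundedOrbitJuliaSet (f : ℂ → ℂ) : Set ℂ :=
  {z ∈ juliaSet f | AllIteratesDefinedAt f z ∧
    Bornology.IsBounded (range fun n : ℕ => f^[n] z)}

end MeromorphicDynamics

end

open Metric

namespace MeromorphicDynamics

/-! ### Holomorphic logarithms and inverses -/

/-! On a tract both `f` and `exp` (from a half-plane) are universal coverings of the same exterior
of a disc, so there is a parametrization `φ` of the tract with `f ∘ φ = exp`
(`exists_isTractParametrization`). Far to the right `φ` has a logarithm `L`, and the maps `L + 2πij`
are inverse branches of `f` in logarithmic coordinates. Since `exp ∘ L` is injective, Bloch's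
theorem gives `|L'(z)| = O(1 / Re z)`, and Koebe distortion makes `L` nearly affine on large discs
(`exists_isTame`).

The dimension bound comes from two inverse steps. Points `c + 4πik` climb a vertical line; `L` sends
them to points whose real parts tend to infinity, and after a turn into `|Im| ≤ π` these are sent by
`L` along the real axis to real parts that again tend to infinity, slowly. While crossing an
interval of length 300, the total variation of these real parts is at least 300, and each step is at
most a constant times the contraction ratio of the corresponding double inverse branch. Hence
finitely many branches map one window into itself with ratios adding up to more than 1
(`exists_branches`). By continuity some `t > 1` still has `∑ q ^ t ≥ 1`, and a Bernoulli measure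
gives dimension at least `t` (`le_dimH_range_of_separated`). The exponential of the limit set
together with its image under `f` is the repeller (`exists_repeller_of_logCoordinate`); expansion
places it in the Julia set by Cauchy's estimate.

For class `B` with finitely many poles, `exp` is lifted through the covering `f` to a map `φ`
staying outside a circle around the poles. If `φ` were not injective it would be periodic and its
image would contain a neighbourhood of infinity on which `f` is bounded away from zero, so `f` would
be rational (`IsLogLift.injOn`). The image of a slightly smaller half-plane is then a tract. -/

theorem differentiableOn_of_comp_eq {U : Set ℂ} (hU : IsOpen U) {l g F : ℂ → ℂ}
    (hl : ContinuousOn l U) (hg : DifferentiableOn ℂ g U) (hF : ∀ z ∈ U, AnalyticAt ℂ F (l z))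
    (hF0 : ∀ z ∈ U, deriv F (l z) ≠ 0) (h : ∀ z ∈ U, F (l z) = g z) : DifferentiableOn ℂ l U := by
  intro z hz
  have hs : HasStrictDerivAt F (deriv F (l z)) (l z) := (hF z hz).hasStrictDerivAt
  have hne := hF0 z hz
  have h1 : ∀ᶠ w in 𝓝 (l z), hs.localInverse _ _ _ hne (F w) = w :=
    (hs.hasStrictFDerivAt_equiv hne).eventually_left_inverse
  have h2 : DifferentiableAt ℂ (hs.localInverse _ _ _ hne) (g z) := by
    rw [← h z hz]
    exact (hs.to_localInverse hne).hasDerivAt.differentiableAt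
  have hlz : ContinuousAt l z := hl.continuousAt (hU.mem_nhds hz)
  -- Continuity keeps `l w` where the local inverse undoes `F`, so `l` is locally a composition of
  -- differentiable maps.
  have h3 : l =ᶠ[𝓝 z] (hs.localInverse _ _ _ hne) ∘ g := by
    filter_upwards [hlz.eventually h1, hU.mem_nhds hz] with w hw hwU
    rw [Function.comp_apply, ← h w hwU, hw]
  exact ((h2.comp z (hg.differentiableAt (hU.mem_nhds hz))).congr_of_eventuallyEq
    h3).differentiableWithinAt

theorem differentiableOn_of_exp_comp {U : Set ℂ} (hU : IsOpen U) {l g : ℂ → ℂ}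
    (hl : ContinuousOn l U) (hg : DifferentiableOn ℂ g U)
    (h : ∀ z ∈ U, Complex.exp (l z) = g z) : DifferentiableOn ℂ l U :=
  differentiableOn_of_comp_eq hU hl hg (fun _ _ => Complex.differentiable_exp.analyticAt _)
    (fun z _ => by rw [Complex.deriv_exp]; exact Complex.exp_ne_zero _) h

theorem exists_log_of_convex {U : Set ℂ} (hU : IsOpen U) (hc : Convex ℝ U) (hne : U.Nonempty)
    {g : ℂ → ℂ} (hg : DifferentiableOn ℂ g U) (h0 : ∀ z ∈ U, g z ≠ 0) :
    ∃ l : ℂ → ℂ, DifferentiableOn ℂ l U ∧ ∀ z ∈ U, Complex.exp (l z) = g z := by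
  have : ContractibleSpace U := hc.contractibleSpace hne
  have hsc : IsSimplyConnected U := inferInstanceAs (SimplyConnectedSpace U)
  obtain ⟨l, hl, hle⟩ := Complex.exists_continuousOn_eqOn_exp_comp hsc hU hg.continuousOn
    (by rintro ⟨z, hz, h⟩; exact h0 z hz h)
  exact ⟨l, differentiableOn_of_exp_comp hU hl hg hle, hle⟩

/-- At a critical point `f - f z = k ^ n` with `n ≥ 2` and `k` a local coordinate. Then `k` attains
both `ε / 2` and `ξ * ε / 2` for a primitive `n`-th root of unity `ξ`, and `f` agrees at these two
points. -/
theorem deriv_ne_zero_of_injOn {U : Set ℂ} (hU : IsOpen U) {f : ℂ → ℂ}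
    (hf : DifferentiableOn ℂ f U) (hinj : InjOn f U) {z : ℂ} (hz : z ∈ U) : deriv f z ≠ 0 := by
  intro hd
  have hfa : AnalyticAt ℂ f z := hf.analyticAt (hU.mem_nhds hz)
  have hfa' : AnalyticAt ℂ (fun w => f w - f z) z := hfa.sub analyticAt_const
  have htop : analyticOrderAt (fun w => f w - f z) z ≠ ⊤ := by
    intro h
    rw [analyticOrderAt_eq_top] at h
    have h1 : ∀ᶠ w in 𝓝[≠] z, f w - f z = 0 := h.filter_mono nhdsWithin_le_nhds
    have h2 : ∀ᶠ w in 𝓝[≠] z, w ∈ U := nhdsWithin_le_nhds (hU.mem_nhds hz)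
    obtain ⟨w, hw1, hw2, hw3⟩ := (h1.and (h2.and self_mem_nhdsWithin)).exists
    exact hw3 (hinj hw2 hz (sub_eq_zero.1 hw1))
  obtain ⟨h, hh, hh0, hfh⟩ := (hfa'.analyticOrderAt_ne_top).1 htop
  set n := analyticOrderNatAt (fun w => f w - f z) z with hn
  have hn0 : n ≠ 0 := by
    intro h0
    have := hfh.self_of_nhds
    rw [h0] at this
    simp at this
    exact hh0 this.symm
  have hn1 : n ≠ 1 := by
    intro h1
    have h2 : HasDerivAt (fun w => (w - z) ^ n • h w) (h z) z := by
      rw [h1]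
      have := ((hasDerivAt_id z).sub_const z).mul hh.differentiableAt.hasDerivAt
      simpa [Pi.mul_def] using this
    have h3 := (h2.congr_of_eventuallyEq hfh).deriv
    rw [deriv_sub_const, hd] at h3
    exact hh0 h3.symm
  obtain ⟨c, hc⟩ := IsAlgClosed.exists_pow_nat_eq (h z) (Nat.pos_of_ne_zero hn0)
  have hc0 : c ≠ 0 := by rintro rfl; rw [zero_pow hn0] at hc; exact hh0 hc.symm
  -- Dividing by `h z` makes the base equal to 1 at `z`, where the principal root is analytic; `c`
  -- restores the factor.
  set k : ℂ → ℂ := fun w => (w - z) * (c * (h w / h z) ^ (1 / n : ℂ)) with hk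
  have hka : AnalyticAt ℂ k z := by
    refine (analyticAt_id.sub analyticAt_const).mul (analyticAt_const.mul ?_)
    refine (hh.div analyticAt_const hh0).cpow analyticAt_const ?_
    simp [div_self hh0]
  have hkn : ∀ᶠ w in 𝓝 z, k w ^ n = f w - f z := by
    filter_upwards [hfh] with w hw
    have hn' : (n : ℂ) ≠ 0 := by exact_mod_cast hn0
    rw [hw, hk, mul_pow, mul_pow, hc, one_div, Complex.cpow_nat_inv_pow _ hn0, smul_eq_mul]
    field_simp
  have hkd : HasStrictDerivAt k c z := by
    have h1 : DifferentiableAt ℂ (fun w => c * (h w / h z) ^ (1 / n : ℂ)) z := by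
      refine AnalyticAt.differentiableAt (analyticAt_const.mul ?_)
      refine (hh.div analyticAt_const hh0).cpow analyticAt_const ?_
      simp [div_self hh0]
    have h2 := ((hasDerivAt_id z).sub_const z).mul h1.hasDerivAt
    have h3 : deriv k z = c := by
      have : HasDerivAt k _ z := h2
      rw [this.deriv]; simp [div_self hh0]
    rw [← h3]
    exact hka.hasStrictDerivAt
  have hmap := hkd.map_nhds_eq hc0
  have hkz : k z = 0 := by simp [hk]
  rw [hkz] at hmap
  have hset : {w | w ∈ U ∧ k w ^ n = f w - f z} ∈ 𝓝 z := by
    filter_upwards [hU.mem_nhds hz, hkn] with w h1 h2 using ⟨h1, h2⟩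
  have him : k '' {w | w ∈ U ∧ k w ^ n = f w - f z} ∈ 𝓝 (0 : ℂ) := by
    rw [← hmap]; exact image_mem_map hset
  obtain ⟨ε, hε, hball⟩ := Metric.mem_nhds_iff.1 him
  have hprim := Complex.isPrimitiveRoot_exp n hn0
  set ξ := Complex.exp (2 * Real.pi * Complex.I / n) with hξ
  have hξn : ‖ξ‖ = 1 := hprim.norm'_eq_one hn0
  have e1 : ((ε / 2 : ℝ) : ℂ) ∈ ball (0 : ℂ) ε := by
    rw [mem_ball_zero_iff, Complex.norm_real, Real.norm_eq_abs, abs_of_pos (by linarith)]; linarith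
  have e2 : ξ * ((ε / 2 : ℝ) : ℂ) ∈ ball (0 : ℂ) ε := by
    rw [mem_ball_zero_iff, norm_mul, hξn, Complex.norm_real, Real.norm_eq_abs,
      abs_of_pos (by linarith)]; linarith
  obtain ⟨w1, ⟨hw1, hw1'⟩, hw1''⟩ := hball e1
  obtain ⟨w2, ⟨hw2, hw2'⟩, hw2''⟩ := hball e2
  have hff : f w1 = f w2 := by
    have : f w1 - f z = f w2 - f z := by
      rw [← hw1', ← hw2', hw1'', hw2'', mul_pow, hprim.pow_eq_one, one_mul]
    exact sub_left_injective this
  have hw := hinj hw1 hw2 hff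
  rw [hw, hw2''] at hw1''
  have hεc : ((ε / 2 : ℝ) : ℂ) ≠ 0 := by
    rw [Complex.ofReal_ne_zero]; linarith
  have : ξ = 1 := by
    have := mul_right_cancel₀ hεc (hw1''.trans (one_mul _).symm)
    exact this
  exact hprim.ne_one (by omega) this

theorem hasDerivAt_invFunOn {U : Set ℂ} (hU : IsOpen U) {f : ℂ → ℂ}
    (hf : DifferentiableOn ℂ f U) (hinj : InjOn f U) {z : ℂ} (hz : z ∈ U) :
    HasDerivAt (Function.invFunOn f U) (deriv f z)⁻¹ (f z) := by
  have hne := deriv_ne_zero_of_injOn hU hf hinj hz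
  have hs : HasStrictDerivAt f (deriv f z) z := (hf.analyticAt (hU.mem_nhds hz)).hasStrictDerivAt
  have h1 := (hs.to_localInverse hne).hasDerivAt
  refine h1.congr_of_eventuallyEq ?_
  have h2 : ∀ᶠ y in 𝓝 (f z), f (hs.localInverse _ _ _ hne y) = y :=
    (hs.hasStrictFDerivAt_equiv hne).eventually_right_inverse
  have h4 : hs.localInverse _ _ _ hne (f z) = z :=
    (hs.hasStrictFDerivAt_equiv hne).localInverse_apply_image
  have h3 : ∀ᶠ y in 𝓝 (f z), hs.localInverse _ _ _ hne y ∈ U := by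
    refine h1.continuousAt.eventually_mem ?_
    rw [h4]; exact hU.mem_nhds hz
  filter_upwards [h2, h3] with y hy1 hy2
  have hmem : ∃ a ∈ U, f a = y := ⟨_, hy2, hy1⟩
  exact hinj (Function.invFunOn_mem hmem) hy2 ((Function.invFunOn_eq hmem).trans hy1.symm)

/-! ### Bloch's theorem and distortion of injective holomorphic functions -/

/-- A holomorphic function whose derivative is close to a constant `d` on a convex set is
close to an affine map. -/
theorem norm_sub_sub_mul_le {s : Set ℂ} (hs : Convex ℝ s) (ho : IsOpen s) {g : ℂ → ℂ}
    (hg : DifferentiableOn ℂ g s) {d : ℂ} {C : ℝ} (h : ∀ z ∈ s, ‖deriv g z - d‖ ≤ C) {x y : ℂ}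
    (hx : x ∈ s) (hy : y ∈ s) : ‖g y - g x - d * (y - x)‖ ≤ C * ‖y - x‖ := by
  have h1 : ∀ z ∈ s, HasDerivWithinAt (fun w => g w - d * w) (deriv g z - d) s z := by
    intro z hz
    have h2 := (hg.differentiableAt (ho.mem_nhds hz)).hasDerivAt
    have h3 := h2.sub ((hasDerivAt_id z).const_mul d)
    rw [mul_one] at h3
    exact h3.hasDerivWithinAt
  have := hs.norm_image_sub_le_of_norm_hasDerivWithin_le h1 h hx hy
  rwa [show g y - g x - d * (y - x) = g y - d * y - (g x - d * x) by ring]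

/-- The Schwarz lemma applied to `deriv g` keeps it within `3a/7` of its central value on the disc
of radius `r/7`. On the circle of radius `r/8` this gives `‖g z - g c‖ ≥ (4a/7)(r/8) ≥ ra/16`, and
the quantitative open mapping theorem concludes. -/
theorem ball_subset_image_of_norm_deriv_le {g : ℂ → ℂ} {c : ℂ} {r : ℝ} (hr : 0 < r)
    (hg : DifferentiableOn ℂ g (ball c r)) (hd : ∀ z ∈ ball c r, ‖deriv g z‖ ≤ 2 * ‖deriv g c‖) :
    ball (g c) (r * ‖deriv g c‖ / 32) ⊆ g '' ball c r := by
  set a := ‖deriv g c‖ with ha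
  rcases (norm_nonneg (deriv g c)).eq_or_lt with h0 | h0
  · rw [ha, ← h0]; simp
  have hg' : DifferentiableOn ℂ (deriv g) (ball c r) := hg.deriv isOpen_ball
  have hmaps : MapsTo (deriv g) (ball c r) (closedBall (deriv g c) (3 * a)) := by
    intro z hz
    rw [mem_closedBall, dist_eq_norm]
    calc ‖deriv g z - deriv g c‖ ≤ ‖deriv g z‖ + ‖deriv g c‖ := norm_sub_le _ _
      _ ≤ 2 * a + a := add_le_add (hd z hz) le_rfl
      _ = 3 * a := by ring
  have hclose : ∀ z ∈ ball c (r / 7), ‖deriv g z - deriv g c‖ ≤ 3 / 7 * a := by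
    intro z hz
    rw [mem_ball] at hz
    have := Complex.dist_le_div_mul_dist_of_mapsTo_ball hg' hmaps
      (mem_ball.2 (hz.trans (by linarith)))
    rw [dist_eq_norm] at this
    calc _ ≤ _ := this
      _ ≤ 3 * a / r * (r / 7) := by gcongr
      _ = _ := by field_simp
  have hb : ball c (r / 7) ⊆ ball c r := ball_subset_ball (by linarith)
  have h8 : closedBall c (r / 8) ⊆ ball c (r / 7) := closedBall_subset_ball (by linarith)
  have hDC : DiffContOnCl ℂ g (ball c (r / 8)) := by
    refine DifferentiableOn.diffContOnCl ?_
    rw [closure_ball _ (by linarith)]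
    exact hg.mono (h8.trans hb)
  have hlow : ∀ z ∈ sphere c (r / 8), r * a / 16 ≤ ‖g z - g c‖ := by
    intro z hz
    have hzc : ‖z - c‖ = r / 8 := by rwa [← dist_eq_norm]
    have := norm_sub_sub_mul_le (convex_ball c (r / 7)) isOpen_ball (hg.mono hb) hclose
      (mem_ball_self (by linarith)) (h8 (sphere_subset_closedBall hz))
    have h2 : ‖deriv g c * (z - c)‖ = a * (r / 8) := by rw [norm_mul, hzc]
    have h3 := norm_sub_norm_le (deriv g c * (z - c)) (deriv g c * (z - c) - (g z - g c))
    rw [sub_sub_cancel, norm_sub_rev (deriv g c * (z - c)), h2] at h3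
    rw [hzc] at this
    nlinarith [mul_pos hr h0]
  have hra : 0 < r * a := mul_pos hr h0
  have hloc : ∃ᶠ z in 𝓝 c, g z ≠ g c := by
    intro hev
    have h2 : g =ᶠ[𝓝 c] fun _ => g c := hev.mono fun z hz => not_not.1 hz
    have h3 := h2.deriv_eq
    rw [deriv_const] at h3
    rw [h3, norm_zero] at h0
    exact h0.false
  have h1 := hDC.ball_subset_image_closedBall (by linarith) hlow hloc
  rw [show r * a / 16 / 2 = r * a / 32 by ring] at h1
  exact h1.trans (image_mono (h8.trans hb))

/-- **Bloch's theorem** with an explicit constant. -/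
theorem exists_ball_subset_image {g : ℂ → ℂ} {c : ℂ} {r : ℝ} (hr : 0 < r)
    (hg : DifferentiableOn ℂ g (ball c r)) :
    ∃ w, ball w (r * ‖deriv g c‖ / 128) ⊆ g '' ball c r := by
  rcases (norm_nonneg (deriv g c)).eq_or_lt with h0 | h0
  · exact ⟨0, by rw [← h0]; simp⟩
  set s := r / 2 with hs
  have hs0 : 0 < s := by positivity
  have hsub : closedBall c s ⊆ ball c r := closedBall_subset_ball (by linarith)
  -- The weight vanishes on the boundary, so the maximum is interior; within half the distance from
  -- the maximizer to the boundary, the derivative at most doubles.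
  have hcont : ContinuousOn (fun z => (s - dist z c) * ‖deriv g z‖) (closedBall c s) := by
    have : ContinuousOn (deriv g) (closedBall c s) :=
      (hg.deriv isOpen_ball).continuousOn.mono hsub
    fun_prop
  obtain ⟨z, hz, hmax⟩ := (isCompact_closedBall c s).exists_isMaxOn
    (nonempty_closedBall.2 hs0.le) hcont
  have hM : s * ‖deriv g c‖ ≤ (s - dist z c) * ‖deriv g z‖ := by
    have := hmax (mem_closedBall_self hs0.le)
    simpa using this
  have hzc : dist z c < s := by
    rcases (mem_closedBall.1 hz).eq_or_lt with h | h
    · rw [h, sub_self, zero_mul] at hM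
      nlinarith [mul_pos hs0 h0]
    · exact h
  set ρ := (s - dist z c) / 2 with hρ
  have hρ0 : 0 < ρ := by linarith
  have hsub2 : ball z ρ ⊆ ball c s := by
    intro w hw
    rw [mem_ball] at *
    linarith [dist_triangle w z c]
  have hsub3 : ball z ρ ⊆ ball c r := hsub2.trans (ball_subset_closedBall.trans hsub)
  have := ball_subset_image_of_norm_deriv_le hρ0 (hg.mono hsub3) (by
    intro w hw
    have h1 := hmax (ball_subset_closedBall (hsub2 hw))
    simp only at h1
    have h2 : ρ ≤ s - dist w c := by
      rw [mem_ball] at hw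
      linarith [dist_triangle w z c]
    have h3 : ρ * ‖deriv g w‖ ≤ (s - dist w c) * ‖deriv g w‖ := by gcongr
    have h4 : ρ * ‖deriv g w‖ ≤ ρ * (2 * ‖deriv g z‖) := by
      calc _ ≤ _ := h3.trans h1
        _ = _ := by rw [hρ]; ring
    exact le_of_mul_le_mul_left h4 hρ0)
  refine ⟨g z, (ball_subset_ball ?_).trans (this.trans (image_mono hsub3))⟩
  have : r * ‖deriv g c‖ / 128 = s * ‖deriv g c‖ / 64 := by rw [hs]; ring
  rw [this]
  have : ρ * ‖deriv g z‖ / 32 = (s - dist z c) * ‖deriv g z‖ / 64 := by rw [hρ]; ring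
  rw [this]
  linarith

/-- A holomorphic branch of the logarithm of an injective function contracts. -/
theorem norm_deriv_le_of_injOn_exp {l : ℂ → ℂ} {c : ℂ} {r : ℝ} (hr : 0 < r)
    (hl : DifferentiableOn ℂ l (ball c r)) (hinj : InjOn (fun z => Complex.exp (l z)) (ball c r)) :
    ‖deriv l c‖ ≤ 512 / r := by
  by_contra! hlt
  rw [div_lt_iff₀ hr] at hlt
  -- If the bound failed, the image of `l` would contain a disc of radius above `π`, hence two
  -- points differing by `2πi`.
  obtain ⟨w, hw⟩ := exists_ball_subset_image hr hl
  have h4 : (4 : ℝ) < r * ‖deriv l c‖ / 128 := by linarith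
  have hπ : ‖(Real.pi : ℂ) * Complex.I‖ < r * ‖deriv l c‖ / 128 := by
    rw [norm_mul, Complex.norm_I, mul_one, Complex.norm_real, Real.norm_eq_abs,
      abs_of_pos Real.pi_pos]
    linarith [Real.pi_lt_four]
  obtain ⟨z1, hz1, h1⟩ := hw (show w + Real.pi * Complex.I ∈ ball w _ by
    rw [mem_ball, dist_eq_norm, add_sub_cancel_left]; exact hπ)
  obtain ⟨z2, hz2, h2⟩ := hw (show w - Real.pi * Complex.I ∈ ball w _ by
    rw [mem_ball, dist_eq_norm, sub_sub_cancel_left, norm_neg]; exact hπ)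
  have h3 : z1 = z2 := hinj hz1 hz2 (by
    simp only [h1, h2]
    rw [show w + Real.pi * Complex.I = (w - Real.pi * Complex.I) + 2 * Real.pi * Complex.I by ring,
      Complex.exp_periodic])
  rw [h3, h2] at h1
  have : (2 * Real.pi * Complex.I : ℂ) = 0 := by linear_combination -h1
  exact Complex.two_pi_I_ne_zero this

/-- The image of an injective holomorphic function omits a point at controlled distance. -/
theorem exists_notMem_image_of_injOn {g : ℂ → ℂ} {c : ℂ} {r : ℝ} (hr : 0 < r)
    (hg : DifferentiableOn ℂ g (ball c r)) (hinj : InjOn g (ball c r)) :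
    ∃ w, w ∉ g '' ball c r ∧ ‖w - g c‖ < 2 * ‖deriv g c‖ * r := by
  by_contra! hcon
  set a := ‖deriv g c‖ with ha
  have hc := mem_ball_self hr (x := c)
  have hne := deriv_ne_zero_of_injOn isOpen_ball hg hinj hc
  have ha0 : 0 < a := norm_pos_iff.2 hne
  -- Otherwise the inverse maps a disc of radius `2ar` into one of radius `r`, and the Schwarz bound
  -- gives `1/a ≤ 1/(2a)`.
  have hsub : ball (g c) (2 * a * r) ⊆ g '' ball c r := by
    intro w hw
    by_contra h
    have := hcon w h
    rw [mem_ball, dist_eq_norm] at hw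
    linarith
  have hinv : Function.invFunOn g (ball c r) (g c) = c :=
    hinj.leftInvOn_invFunOn hc
  have hdiff : DifferentiableOn ℂ (Function.invFunOn g (ball c r)) (ball (g c) (2 * a * r)) := by
    intro w hw
    obtain ⟨z, hz, rfl⟩ := hsub hw
    exact (hasDerivAt_invFunOn isOpen_ball hg hinj hz).differentiableAt.differentiableWithinAt
  have hm : MapsTo (Function.invFunOn g (ball c r)) (ball (g c) (2 * a * r))
      (closedBall (Function.invFunOn g (ball c r) (g c)) r) := by
    intro w hw
    rw [hinv]
    exact ball_subset_closedBall (Function.invFunOn_mem (hsub hw))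
  have := Complex.norm_deriv_le_div_of_mapsTo_ball hdiff hm (by positivity)
  rw [(hasDerivAt_invFunOn isOpen_ball hg hinj hc).deriv, norm_inv, ← ha] at this
  rw [inv_eq_one_div, div_le_div_iff₀ ha0 (by positivity)] at this
  nlinarith [mul_pos ha0 hr]

/-- With an omitted value `w` near `g c`, a logarithm of `w - g` has derivative at most `1024/r` on
the half-size disc, so it varies by at most 1 on the tiny disc and `‖w - g z‖ ≤ 3 ‖w - g c‖`. -/
theorem norm_sub_le_of_injOn {g : ℂ → ℂ} {c : ℂ} {r : ℝ} (hr : 0 < r)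
    (hg : DifferentiableOn ℂ g (ball c r)) (hinj : InjOn g (ball c r)) {z : ℂ}
    (hz : z ∈ ball c (r / 1024)) : ‖g z - g c‖ ≤ 8 * ‖deriv g c‖ * r := by
  obtain ⟨w, hw, hwc⟩ := exists_notMem_image_of_injOn hr hg hinj
  have hc := mem_ball_self hr (x := c)
  have hne : ∀ z ∈ ball c r, w - g z ≠ 0 := by
    intro z hz h
    exact hw ⟨z, hz, (sub_eq_zero.1 h).symm⟩
  have hgw : DifferentiableOn ℂ (fun z => w - g z) (ball c r) := hg.const_sub w
  obtain ⟨l, hl, hle⟩ := exists_log_of_convex isOpen_ball (convex_ball c r) ⟨c, hc⟩ hgw hne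
  have hlinj : InjOn (fun z => Complex.exp (l z)) (ball c r) := by
    intro x hx y hy hxy
    simp only [hle x hx, hle y hy] at hxy
    exact hinj hx hy (by linear_combination -hxy)
  have hd : ∀ y ∈ ball c (r / 2), ‖deriv l y‖ ≤ 1024 / r := by
    intro y hy
    have hsub : ball y (r / 2) ⊆ ball c r := by
      intro x hx
      rw [mem_ball] at *
      linarith [dist_triangle x y c]
    have := norm_deriv_le_of_injOn_exp (by positivity) (hl.mono hsub) (hlinj.mono hsub)
    calc _ ≤ _ := this
      _ = _ := by field_simp; norm_num
  have hsub : ball c (r / 1024) ⊆ ball c (r / 2) := ball_subset_ball (by linarith)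
  have hsub2 : ball c (r / 2) ⊆ ball c r := ball_subset_ball (by linarith)
  have hlz : ‖l z - l c‖ ≤ 1 := by
    have := (convex_ball c (r / 2)).norm_image_sub_le_of_norm_deriv_le (𝕜 := ℂ)
      (fun y hy => hl.differentiableAt (isOpen_ball.mem_nhds (hsub2 hy))) hd
      (mem_ball_self (by positivity)) (hsub hz)
    rw [mem_ball, dist_eq_norm] at hz
    calc _ ≤ _ := this
      _ ≤ 1024 / r * (r / 1024) := by gcongr
      _ = 1 := by field_simp
  have hq : w - g z = Complex.exp (l z - l c) * (w - g c) := by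
    rw [Complex.exp_sub, hle z (hsub2 (hsub hz)), hle c hc]
    field_simp [hne c hc]
  have hexp : ‖Complex.exp (l z - l c)‖ ≤ 3 := by
    rw [Complex.norm_exp]
    calc Real.exp (l z - l c).re ≤ Real.exp 1 :=
          Real.exp_le_exp.2 ((Complex.re_le_norm _).trans hlz)
      _ ≤ 3 := by linarith [Real.exp_one_lt_d9]
  calc ‖g z - g c‖ = ‖(w - g c) - (w - g z)‖ := by congr 1; ring
    _ ≤ ‖w - g c‖ + ‖w - g z‖ := norm_sub_le _ _
    _ ≤ ‖w - g c‖ + 3 * ‖w - g c‖ := by rw [hq, norm_mul]; gcongr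
    _ ≤ 8 * ‖deriv g c‖ * r := by linarith

/-- **Koebe distortion** (qualitative form): the derivative of an injective holomorphic function
is almost constant on much smaller discs. -/
theorem norm_deriv_sub_deriv_le_of_injOn {g : ℂ → ℂ} {c : ℂ} {r : ℝ} (hr : 0 < r)
    (hg : DifferentiableOn ℂ g (ball c r)) (hinj : InjOn g (ball c r)) {z : ℂ}
    (hz : z ∈ ball c (r / 2 ^ 30)) : ‖deriv g z - deriv g c‖ ≤ ‖deriv g c‖ / 2 := by
  have hc := mem_ball_self hr (x := c)
  have hne := deriv_ne_zero_of_injOn isOpen_ball hg hinj hc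
  set a := ‖deriv g c‖ with ha
  have ha0 : 0 < a := norm_pos_iff.2 hne
  have hsub : ball c (r / 2048) ⊆ ball c r := ball_subset_ball (by linarith)
  -- Cauchy's estimate at radius `r/4096` turns the bound `8ar` into `2^15 a`. The Schwarz lemma for
  -- `deriv g` then gains `2^11 / 2^30` against `2^17 a`, leaving `a/4`.
  have hd : ∀ y ∈ ball c (r / 2048), ‖deriv g y‖ ≤ 2 ^ 16 * a := by
    intro y hy
    rw [mem_ball] at hy
    have hsub2 : ∀ x ∈ closedBall y (r / 4096), x ∈ ball c (r / 1024) := by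
      intro x hx
      rw [mem_ball]
      rw [mem_closedBall] at hx
      linarith [dist_triangle x y c]
    have hD : DiffContOnCl ℂ (fun x => g x - g c) (ball y (r / 4096)) := by
      refine DifferentiableOn.diffContOnCl ?_
      rw [closure_ball _ (by positivity)]
      refine DifferentiableOn.sub_const ?_ _
      exact hg.mono fun x hx => ball_subset_ball (by linarith) (hsub2 x hx)
    have := Complex.norm_deriv_le_of_forall_mem_sphere_norm_le (by positivity) hD
      (fun x hx => norm_sub_le_of_injOn hr hg hinj (hsub2 x (sphere_subset_closedBall hx)))
    rw [deriv_sub_const] at this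
    calc _ ≤ _ := this
      _ = 2 ^ 15 * a := by rw [← ha]; field_simp; norm_num
      _ ≤ _ := by gcongr <;> norm_num
  have hmaps : MapsTo (deriv g) (ball c (r / 2048)) (closedBall (deriv g c) (2 ^ 17 * a)) := by
    intro y hy
    rw [mem_closedBall, dist_eq_norm]
    calc ‖deriv g y - deriv g c‖ ≤ ‖deriv g y‖ + ‖deriv g c‖ := norm_sub_le _ _
      _ ≤ 2 ^ 16 * a + a := add_le_add (hd y hy) le_rfl
      _ ≤ 2 ^ 17 * a := by linarith
  rw [mem_ball] at hz
  have := Complex.dist_le_div_mul_dist_of_mapsTo_ball ((hg.deriv isOpen_ball).mono hsub) hmaps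
    (mem_ball.2 (hz.trans (by linarith)))
  rw [dist_eq_norm] at this
  calc _ ≤ _ := this
    _ ≤ 2 ^ 17 * a / (r / 2048) * (r / 2 ^ 30) := by gcongr
    _ = a / 4 := by field_simp; norm_num
    _ ≤ a / 2 := by linarith

theorem le_norm_sub_of_injOn {g : ℂ → ℂ} {c : ℂ} {r : ℝ} (hr : 0 < r)
    (hg : DifferentiableOn ℂ g (ball c r)) (hinj : InjOn g (ball c r)) {x y : ℂ}
    (hx : x ∈ ball c (r / 2 ^ 30)) (hy : y ∈ ball c (r / 2 ^ 30)) :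
    ‖deriv g c‖ / 2 * ‖x - y‖ ≤ ‖g x - g y‖ := by
  have hsub : ball c (r / 2 ^ 30) ⊆ ball c r := ball_subset_ball (by linarith)
  have h1 := norm_sub_sub_mul_le (convex_ball c _) isOpen_ball (hg.mono hsub)
    (fun z hz => norm_deriv_sub_deriv_le_of_injOn hr hg hinj hz) hy hx
  have h3 := norm_sub_norm_le (deriv g c * (x - y)) (deriv g c * (x - y) - (g x - g y))
  rw [sub_sub_cancel, norm_sub_rev (deriv g c * (x - y)), norm_mul] at h3
  linarith

/-! ### Coding of limit sets of iterated function systems -/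

section Coding

variable {ι : Type*} [Fintype ι] [TopologicalSpace ι] [DiscreteTopology ι]

/-- The coding map is the fixed point of a contraction on the complete space of continuous maps from
sequences to `Q`, so its continuity is automatic. -/
theorem exists_codeMap {Q : Set ℂ} (hQ : IsCompact Q) (hne : Q.Nonempty) {ψ : ι → ℂ → ℂ}
    (hmaps : ∀ i, MapsTo (ψ i) Q Q)
    (hlip : ∀ i, ∀ x ∈ Q, ∀ y ∈ Q, dist (ψ i x) (ψ i y) ≤ 1 / 2 * dist x y) :
    ∃ ζ : (ℕ → ι) → ℂ, Continuous ζ ∧ (∀ ω, ζ ω ∈ Q) ∧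
      ∀ ω, ζ ω = ψ (ω 0) (ζ fun n => ω (n + 1)) := by
  have : CompactSpace Q := isCompact_iff_compactSpace.1 hQ
  have : Nonempty Q := hne.to_subtype
  have hψc : ∀ i, Continuous ((hmaps i).restrict (ψ i) Q Q) := fun i =>
    (LipschitzWith.of_dist_le_mul (K := 1 / 2) fun x y => by
      simpa [Subtype.dist_eq] using hlip i x x.2 y y.2).continuous
  have hcont : Continuous fun p : ι × Q => (hmaps p.1).restrict (ψ p.1) Q Q p.2 :=
    continuous_prod_of_discrete_left.2 hψc
  let Φ : C(ℕ → ι, Q) → C(ℕ → ι, Q) := fun ζ =>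
    ⟨fun ω => (hmaps (ω 0)).restrict (ψ (ω 0)) Q Q (ζ fun n => ω (n + 1)),
      hcont.comp (f := fun ω : ℕ → ι => (ω 0, ζ fun n => ω (n + 1))) (by fun_prop)⟩
  have hΦ : ContractingWith (1 / 2) Φ := by
    refine ⟨by rw [← NNReal.coe_lt_coe]; norm_num, LipschitzWith.of_dist_le_mul fun ζ ξ => ?_⟩
    rw [ContinuousMap.dist_le (by positivity)]
    intro ω
    calc _ ≤ 1 / 2 * dist (ζ fun n => ω (n + 1)) (ξ fun n => ω (n + 1)) :=
          hlip _ _ (Subtype.prop _) _ (Subtype.prop _)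
      _ ≤ 1 / 2 * dist ζ ξ := by gcongr; exact ContinuousMap.dist_apply_le_dist _
      _ = _ := by simp
  have : Nonempty C(ℕ → ι, Q) := ⟨.const _ (Classical.arbitrary Q)⟩
  refine ⟨fun ω => (hΦ.fixedPoint Φ) ω, by fun_prop, fun ω => Subtype.prop _, fun ω => ?_⟩
  have h := hΦ.fixedPoint_isFixedPt
  conv_lhs => rw [← h]
  rfl

/-- Lower bound for the Hausdorff dimension of a set coded by sequences. -/
theorem le_dimH_range_of_separated {π : (ℕ → ι) → ℂ} (hπ : Continuous π) {q : ι → ℝ}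
    (hq0 : ∀ i, 0 < q i) (hq1 : ∀ i, q i < 1) {t : NNReal} (ht : 0 < t)
    (hsum : 1 ≤ ∑ i, q i ^ (t : ℝ)) {δ : ℝ} (hδ : 0 < δ)
    (hsep : ∀ (ω ω' : ℕ → ι) (n : ℕ), (∀ m < n, ω m = ω' m) → ω n ≠ ω' n →
      δ * ∏ m ∈ Finset.range n, q (ω m) ≤ dist (π ω) (π ω')) :
    (t : ENNReal) ≤ dimH (range π) := by
  classical
  let _ : MeasurableSpace ι := borel ι
  have _ : BorelSpace ι := ⟨rfl⟩
  have ht' : (0 : ℝ) < t := ht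
  set S := ∑ i, q i ^ (t : ℝ) with hS
  have hS0 : 0 < S := by linarith
  have hpos : ∀ i, 0 < q i ^ (t : ℝ) := fun i => Real.rpow_pos_of_pos (hq0 i) _
  have hone : ∑ i, ENNReal.ofReal (q i ^ (t : ℝ) / S) = 1 := by
    rw [← ENNReal.ofReal_sum_of_nonneg (fun i _ => (div_pos (hpos i) hS0).le), ← Finset.sum_div,
      div_self hS0.ne', ENNReal.ofReal_one]
  -- Mass distribution principle with the Bernoulli measure of weights `q i ^ t / S`; since `S ≥ 1`,
  -- a cylinder has mass at most `(∏ q) ^ t`.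
  let P : PMF ι := PMF.ofFintype _ hone
  let μ : MeasureTheory.Measure (ℕ → ι) := MeasureTheory.Measure.infinitePi fun _ => P.toMeasure
  have hcyl : ∀ (ω : ℕ → ι) (n : ℕ), μ {ω' | ∀ m < n, ω' m = ω m} ≤
      ENNReal.ofReal ((∏ m ∈ Finset.range n, q (ω m)) ^ (t : ℝ)) := by
    intro ω n
    have h1 : {ω' : ℕ → ι | ∀ m < n, ω' m = ω m} =
        Set.pi (Finset.range n) fun m => {ω m} := by
      ext ω'; simp [Set.mem_pi]
    rw [h1, MeasureTheory.Measure.infinitePi_pi _ fun _ _ => measurableSet_singleton _]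
    rw [← Real.finsetProd_rpow _ _ fun i _ => (hq0 _).le,
      ENNReal.ofReal_prod_of_nonneg fun i _ => (hpos _).le]
    refine Finset.prod_le_prod' fun m _ => ?_
    rw [PMF.toMeasure_apply_singleton _ _ (measurableSet_singleton _)]
    exact ENNReal.ofReal_le_ofReal (div_le_self (hpos _).le hsum)
  have hsingle : ∀ ω, μ {ω} = 0 := by
    intro ω
    have : Nonempty ι := ⟨ω 0⟩
    obtain ⟨i, hi⟩ := Finite.exists_max q
    have hlim : Tendsto (fun n : ℕ => ENNReal.ofReal ((q i ^ n) ^ (t : ℝ))) atTop (𝓝 0) := by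
      have h1 := (tendsto_pow_atTop_nhds_zero_of_lt_one (hq0 i).le (hq1 i)).rpow_const
        (p := (t : ℝ)) (Or.inr ht'.le)
      rw [Real.zero_rpow ht'.ne'] at h1
      simpa using ENNReal.tendsto_ofReal h1
    refine le_antisymm (ge_of_tendsto' hlim fun n => ?_) zero_le
    calc μ {ω} ≤ μ {ω' | ∀ m < n, ω' m = ω m} :=
          MeasureTheory.measure_mono (by rintro _ rfl; simp)
      _ ≤ _ := hcyl ω n
      _ ≤ _ := by
        gcongr
        · exact Finset.prod_nonneg fun m _ => (hq0 _).le
        · calc ∏ m ∈ Finset.range n, q (ω m) ≤ ∏ m ∈ Finset.range n, q i :=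
              Finset.prod_le_prod (fun m _ => (hq0 _).le) fun m _ => hi _
            _ = q i ^ n := by simp
  have hmain : ∀ s : Set ℂ, μ.map π s ≤ ENNReal.ofReal (δ⁻¹ ^ (t : ℝ)) * ediam s ^ (t : ℝ) := by
    intro s
    -- Passing to the closure makes the preimage measurable and keeps the diameter.
    rw [← Metric.ediam_closure s]
    refine (MeasureTheory.measure_mono subset_closure).trans ?_
    rw [MeasureTheory.Measure.map_apply hπ.measurable isClosed_closure.measurableSet]
    set A := π ⁻¹' closure s with hA
    by_cases hsub : A.Subsingleton
    · rcases hsub.eq_empty_or_singleton with h | ⟨ω, h⟩ <;> rw [h] <;> simp [hsingle]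
    rw [Set.not_subsingleton_iff] at hsub
    have hfirst : ∀ ω ω' : ℕ → ι, ω ≠ ω' → ∃ n, (∀ m < n, ω m = ω' m) ∧ ω n ≠ ω' n := by
      intro ω ω' h
      have h' := Function.ne_iff.1 h
      exact ⟨Nat.find h', fun m hm => not_not.1 (Nat.find_min h' hm), Nat.find_spec h'⟩
    -- For the least such `n`, all of `A` lies in one cylinder of length `n`, while two of its
    -- points separate at index `n`; so the mass of `A` is controlled by the diameter.
    have hex : ∃ n, ∃ ω ∈ A, ∃ ω' ∈ A, (∀ m < n, ω m = ω' m) ∧ ω n ≠ ω' n := by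
      obtain ⟨ω, hω, ω', hω', hne⟩ := hsub
      obtain ⟨n, hn⟩ := hfirst ω ω' hne
      exact ⟨n, ω, hω, ω', hω', hn⟩
    obtain ⟨ω, hω, ω', hω', heq, hne⟩ := Nat.find_spec hex
    set n := Nat.find hex with hn
    have hAcyl : A ⊆ {ξ | ∀ m < n, ξ m = ω m} := by
      intro ξ hξ
      by_contra hcon
      have hne' : ξ ≠ ω := by rintro rfl; exact hcon fun m _ => rfl
      obtain ⟨k, hk1, hk2⟩ := hfirst ξ ω hne'
      have hkn : k < n := by
        by_contra! h
        exact hcon fun m hm => hk1 m (hm.trans_le h)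
      exact Nat.find_min hex hkn ⟨ξ, hξ, ω, hω, hk1, hk2⟩
    have hs := hsep ω ω' n heq hne
    have hprod : 0 ≤ ∏ m ∈ Finset.range n, q (ω m) := Finset.prod_nonneg fun m _ => (hq0 _).le
    calc μ A ≤ μ {ξ | ∀ m < n, ξ m = ω m} := MeasureTheory.measure_mono hAcyl
      _ ≤ _ := hcyl ω n
      _ ≤ ENNReal.ofReal ((δ⁻¹ * dist (π ω) (π ω')) ^ (t : ℝ)) := by
        gcongr
        rw [inv_mul_eq_div, le_div_iff₀ hδ]
        linarith
      _ = ENNReal.ofReal (δ⁻¹ ^ (t : ℝ)) * edist (π ω) (π ω') ^ (t : ℝ) := by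
        rw [Real.mul_rpow (by positivity) dist_nonneg, ENNReal.ofReal_mul (by positivity),
          edist_dist, ENNReal.ofReal_rpow_of_nonneg dist_nonneg ht'.le]
      _ ≤ _ := by
        gcongr
        exact Metric.edist_le_ediam_of_mem hω hω'
  set C := ENNReal.ofReal (δ⁻¹ ^ (t : ℝ)) with hC
  have hC0 : C ≠ 0 := by
    rw [hC, Ne, ENNReal.ofReal_eq_zero, not_le]; positivity
  have hle : C⁻¹ • μ.map π ≤ MeasureTheory.Measure.hausdorffMeasure (t : ℝ) := by
    refine MeasureTheory.Measure.le_hausdorffMeasure _ _ 1 one_pos fun s _ => ?_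
    rw [MeasureTheory.Measure.smul_apply, smul_eq_mul]
    calc _ ≤ C⁻¹ * (C * ediam s ^ (t : ℝ)) := by gcongr; exact hmain s
      _ = _ := by rw [← mul_assoc, ENNReal.inv_mul_cancel hC0 ENNReal.ofReal_ne_top, one_mul]
  refine le_dimH_of_hausdorffMeasure_ne_zero fun h0 => ?_
  have h1 := hle (range π)
  rw [h0, MeasureTheory.Measure.smul_apply, smul_eq_mul,
    MeasureTheory.Measure.map_apply_of_aemeasurable hπ.measurable.aemeasurable
      (isCompact_range hπ).measurableSet, preimage_range, MeasureTheory.measure_univ] at h1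
  simp [ENNReal.ofReal_ne_top, hC] at h1

end Coding

/-- Continuity in the exponent at 1; this is where the strict inequality for the dimension comes
from. -/
theorem exists_rpow_sum_ge_one {ι : Type*} [Fintype ι] {q : ι → ℝ} (hq0 : ∀ i, 0 < q i) (hsum : 1 < ∑ i, q i) :
    ∃ t : NNReal, 1 < t ∧ 1 ≤ ∑ i, q i ^ (t : ℝ) := by
  have hc : ContinuousAt (fun t : ℝ => ∑ i, q i ^ t) 1 := by
    refine tendsto_finsetSum _ fun i _ => ?_
    exact (Real.continuousAt_const_rpow (hq0 i).ne')
  have h1 : ∀ᶠ t in 𝓝 (1 : ℝ), 1 < ∑ i, q i ^ t :=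
    hc.eventually_const_lt (by simpa using hsum)
  obtain ⟨t, ht, ht1⟩ := ((h1.filter_mono nhdsWithin_le_nhds).and
    (self_mem_nhdsWithin : Ioi (1 : ℝ) ∈ 𝓝[>] 1)).exists
  have ht1' : (1 : ℝ) < t := ht1
  exact ⟨⟨t, by linarith⟩, ht1', ht.le⟩

/-! ### Points of the Julia set -/

/-- A bounded part of the plane has positive chordal distance from a neighbourhood of infinity. This
turns spherical convergence into Euclidean bounds. -/
theorem exists_norm_le_of_chordalDist_lt (A : ℝ) : ∃ ε > 0, ∃ B : ℝ, ∀ p : ℂ, ‖p‖ ≤ A →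
    ∀ q : OnePoint ℂ, chordalDist p q < ε → ∃ w : ℂ, q = w ∧ ‖w‖ ≤ B := by
  have hs : 0 < √(1 + A ^ 2) := by positivity
  refine ⟨1 / (2 * √(1 + A ^ 2)), by positivity, 2 * A + 1, fun p hp q hq => ?_⟩
  have hA : 0 ≤ A := (norm_nonneg p).trans hp
  have hle : √(1 + ‖p‖ ^ 2) ≤ √(1 + A ^ 2) := by gcongr
  have hp0 : 0 < √(1 + ‖p‖ ^ 2) := by positivity
  induction q using OnePoint.rec with
  | infty =>
    exfalso
    have h1 : chordalDist (p : OnePoint ℂ) OnePoint.infty = 2 / √(1 + ‖p‖ ^ 2) := rfl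
    rw [h1, div_lt_div_iff₀ hp0 (by positivity)] at hq
    linarith
  | coe w =>
    refine ⟨w, rfl, ?_⟩
    by_contra! hw
    have h1 : chordalDist (p : OnePoint ℂ) (w : OnePoint ℂ) =
        2 * ‖p - w‖ / (√(1 + ‖p‖ ^ 2) * √(1 + ‖w‖ ^ 2)) := rfl
    have hw0 : 0 < √(1 + ‖w‖ ^ 2) := by positivity
    have hw2 : √(1 + ‖w‖ ^ 2) ≤ 2 * ‖w‖ := by
      rw [Real.sqrt_le_left (by positivity)]
      nlinarith
    have h2 : ‖w‖ / 2 ≤ ‖p - w‖ := by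
      have := norm_sub_norm_le w p
      rw [norm_sub_rev] at this
      linarith
    rw [h1, div_lt_div_iff₀ (by positivity) (by positivity)] at hq
    have h3 : √(1 + ‖p‖ ^ 2) * √(1 + ‖w‖ ^ 2) ≤ √(1 + A ^ 2) * (2 * ‖w‖) := by gcongr
    nlinarith

theorem chordalDist_coe_comm (p q : ℂ) :
    chordalDist (p : OnePoint ℂ) (q : OnePoint ℂ) = chordalDist (q : OnePoint ℂ) p := by
  change 2 * ‖p - q‖ / (√(1 + ‖p‖ ^ 2) * √(1 + ‖q‖ ^ 2)) =
    2 * ‖q - p‖ / (√(1 + ‖q‖ ^ 2) * √(1 + ‖p‖ ^ 2))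
  rw [norm_sub_rev, mul_comm (√(1 + ‖p‖ ^ 2))]

theorem analyticAt_of_notMem_poles {f : ℂ → ℂ} (hf : MeromorphicNFOn f univ) {z : ℂ}
    (hz : z ∉ poles f) : AnalyticAt ℂ f z :=
  (hf (mem_univ z)).meromorphicOrderAt_nonneg_iff_analyticAt.1 (not_lt.1 hz)

theorem notMem_poles_of_analyticAt {f : ℂ → ℂ} {z : ℂ} (hf : AnalyticAt ℂ f z) : z ∉ poles f :=
  not_lt.2 hf.meromorphicOrderAt_nonneg

theorem differentiableAt_iterate {f : ℂ → ℂ} {z : ℂ}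
    (h : ∀ n, DifferentiableAt ℂ f (f^[n] z)) (n : ℕ) : DifferentiableAt ℂ f^[n] z := by
  induction n with
  | zero => exact differentiableAt_id
  | succ n ih =>
    rw [Function.iterate_succ']
    exact (h n).comp z ih

theorem deriv_iterate_add {f : ℂ → ℂ} {z : ℂ}
    (h : ∀ n, DifferentiableAt ℂ f (f^[n] z)) (m n : ℕ) :
    deriv f^[m + n] z = deriv f^[m] (f^[n] z) * deriv f^[n] z := by
  rw [Function.iterate_add]
  refine deriv_comp z ?_ (differentiableAt_iterate h n)
  refine differentiableAt_iterate (fun k => ?_) m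
  rw [← Function.iterate_add_apply]
  exact h _

/-- A point with a bounded orbit along which the derivatives of the iterates blow up is in the
Julia set. -/
theorem mem_juliaSet_of_tendsto_deriv {f : ℂ → ℂ} (hf : MeromorphicNFOn f univ) {z : ℂ} {M : ℝ}
    {k : ℕ → ℕ} (hM : ∀ n, ‖f^[n] z‖ ≤ M)
    (hd : Tendsto (fun n => ‖deriv f^[k n] z‖) atTop atTop) : z ∈ juliaSet f := by
  rintro ⟨U, hU, hzU, hdef, hnorm⟩
  obtain ⟨φ, hφ, h, hconv⟩ := hnorm (fun n => f^[k n]) fun n => ⟨k n, rfl⟩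
  have hdiff : ∀ w ∈ U, ∀ n, DifferentiableAt ℂ f^[n] w := fun w hw n =>
    differentiableAt_iterate
      (fun n => (analyticAt_of_notMem_poles hf (hdef w hw n)).differentiableAt) n
  -- Near `z` one member of the convergent subsequence is bounded by `M + 1`; `ε₁` transfers a bound
  -- to the limit and `ε₂` from the limit to all later members, whose derivatives Cauchy's estimate
  -- then bounds.
  obtain ⟨ε₁, hε₁, B₁, hB₁⟩ := exists_norm_le_of_chordalDist_lt (M + 1)
  obtain ⟨ε₂, hε₂, B₂, hB₂⟩ := exists_norm_le_of_chordalDist_lt B₁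
  obtain ⟨r, hr, hrU⟩ := nhds_basis_closedBall.mem_iff.1 (hU.mem_nhds hzU)
  obtain ⟨N, hN⟩ := hconv _ hrU (isCompact_closedBall z r) (min ε₁ ε₂) (lt_min hε₁ hε₂)
  have hcont : ∀ᶠ w in 𝓝 z, ‖f^[k (φ N)] w‖ < M + 1 :=
    (hdiff z hzU _).continuousAt.norm.eventually_lt_const (by linarith [hM (k (φ N))])
  obtain ⟨s, hs, hsub⟩ := nhds_basis_closedBall.mem_iff.1
    (inter_mem hcont (closedBall_mem_nhds z hr))
  have hbd : ∀ n ≥ N, ∀ w ∈ closedBall z s, ‖f^[k (φ n)] w‖ ≤ B₂ := by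
    intro n hn w hw
    obtain ⟨hw1, hw2⟩ := hsub hw
    obtain ⟨ζ, hζ, hζB⟩ := hB₁ _ (le_of_lt hw1) (h w)
      ((hN N le_rfl w hw2).trans_le (min_le_left _ _))
    have h1 := (hN n hn w hw2).trans_le (min_le_right _ _)
    simp only [hζ] at h1
    rw [chordalDist_coe_comm] at h1
    obtain ⟨ξ, hξ, hξB⟩ := hB₂ _ hζB _ h1
    rwa [← OnePoint.coe_injective hξ] at hξB
  have hder : ∀ n ≥ N, ‖deriv f^[k (φ n)] z‖ ≤ B₂ / s := by
    intro n hn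
    refine Complex.norm_deriv_le_of_forall_mem_sphere_norm_le hs ?_
      fun w hw => hbd n hn w (sphere_subset_closedBall hw)
    refine DifferentiableOn.diffContOnCl fun w hw => ?_
    rw [closure_ball _ hs.ne'] at hw
    exact (hdiff w (hrU (hsub hw).2) _).differentiableWithinAt
  obtain ⟨n, hn1, hn2⟩ := (((hd.comp hφ.tendsto_atTop).eventually_gt_atTop (B₂ / s)).and
    (eventually_ge_atTop N)).exists
  exact absurd (hder n hn2) (not_le.2 hn1)

/-! ### Repellers coded by sequences -/

theorem accPt_of_tendsto {u : ℕ → ℂ} {x : ℂ} {C : Set ℂ} (hu : Tendsto u atTop (𝓝 x))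
    (hC : ∀ n, u n ∈ C) (hne : ∀ n, u n ≠ x) : AccPt x (𝓟 C) := by
  rw [accPt_iff_frequently]
  exact hu.frequently (Frequently.of_forall fun n => ⟨hne n, hC n⟩)

section Repeller

variable {ι : Type*} [Fintype ι] [TopologicalSpace ι] [DiscreteTopology ι]

/-- Each range is a homeomorphic copy of the sequence space, where altering the `n`-th letter gives
points converging to a given one. A preconnected subset lies in one of the two disjoint compact
pieces. -/
theorem isCantorSet_range_union {e g : (ℕ → ι) → ℂ} [Nontrivial ι] (he : Continuous e)
    (hg : Continuous g) (he' : Function.Injective e) (hg' : Function.Injective g)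
    (hdisj : Disjoint (range e) (range g)) : IsCantorSet (range e ∪ range g) := by
  classical
  obtain ⟨a, b, hab⟩ := exists_pair_ne ι
  have hpert : ∀ (ω : ℕ → ι), ∃ u : ℕ → ℕ → ι, Tendsto u atTop (𝓝 ω) ∧ ∀ n, u n ≠ ω := by
    intro ω
    refine ⟨fun n => Function.update ω n (if ω n = a then b else a), ?_, fun n h => ?_⟩
    · rw [tendsto_pi_nhds]
      intro m
      refine tendsto_const_nhds.congr' ?_
      filter_upwards [eventually_gt_atTop m] with n hn
      rw [Function.update_of_ne hn.ne]
    · have := congrFun h n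
      simp only [Function.update_self] at this
      split_ifs at this with h1
      · exact hab (h1.symm.trans this.symm)
      · exact h1 this.symm
  have hacc : ∀ g : (ℕ → ι) → ℂ, Continuous g → Function.Injective g →
      ∀ x ∈ range g, AccPt x (𝓟 (range g)) := by
    rintro g hg hg' _ ⟨ω, rfl⟩
    obtain ⟨u, hu, hne⟩ := hpert ω
    exact accPt_of_tendsto ((hg.tendsto ω).comp hu) (fun n => mem_range_self _)
      fun n h => hne n (hg' h)
  have htd : ∀ g : (ℕ → ι) → ℂ, Continuous g → Function.Injective g →
      IsTotallyDisconnected (range g) := fun g hg hg' =>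
    (hg.isClosedEmbedding hg').isEmbedding.isTotallyDisconnected_range.2 inferInstance
  have hce := isCompact_range he
  have hcg := isCompact_range hg
  refine ⟨(range_nonempty e).mono subset_union_left, hce.union hcg, ?_, ?_⟩
  · rintro x (hx | hx)
    · exact (hacc e he he' x hx).mono (principal_mono.2 subset_union_left)
    · exact (hacc g hg hg' x hx).mono (principal_mono.2 subset_union_right)
  · intro S hS hpre
    rcases isPreconnected_iff_subset_of_disjoint_closed.1 hpre _ _ hce.isClosed hcg.isClosed hS
      (by rw [hdisj.inter_eq, inter_empty]) with h | h
    · exact htd e he he' S h hpre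
    · exact htd g hg hg' S h hpre

/-- `f` exchanges the two pieces and `f^[2]` acts on the first as the shift, so expansion there is
at least `2 ^ n` after `2n` steps. -/
theorem isExpandingCantorRepeller_of_coding {f : ℂ → ℂ} (hf : MeromorphicNFOn f univ) {T : Set ℂ}
    (hT : IsOpen T) (hfT : DifferentiableOn ℂ f T) [Nontrivial ι] {e : (ℕ → ι) → ℂ}
    (he : Continuous e) (heT : ∀ ω, e ω ∈ T) (hfeT : ∀ ω, f (e ω) ∈ T)
    (hshift : ∀ ω, f (f (e ω)) = e fun n => ω (n + 1))
    (hinj : Function.Injective fun ω => f (e ω)) (hdisj : ∀ ω ω', e ω ≠ f (e ω'))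
    (hexp : ∀ ω, 2 ≤ ‖deriv f^[2] (e ω)‖) :
    IsExpandingCantorRepeller f (range e ∪ range fun ω => f (e ω)) := by
  set X := range e ∪ range fun ω => f (e ω) with hX
  have hfe : Continuous fun ω => f (e ω) := hfT.continuousOn.comp_continuous he heT
  have hcantor : IsCantorSet X := isCantorSet_range_union he hfe
    (fun a b h => hinj (by simp only [h])) hinj (by
      rw [Set.disjoint_left]; rintro _ ⟨ω, rfl⟩ ⟨ω', h⟩; exact hdisj ω ω' h.symm)
  have hXT : X ⊆ T := by
    rintro _ (⟨ω, rfl⟩ | ⟨ω, rfl⟩)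
    exacts [heT ω, hfeT ω]
  have hfX : MapsTo f X X := by
    rintro _ (⟨ω, rfl⟩ | ⟨ω, rfl⟩)
    · exact Or.inr ⟨ω, rfl⟩
    · exact Or.inl ⟨_, (hshift ω).symm⟩
  have hdX : ∀ z ∈ X, ∀ n, DifferentiableAt ℂ f (f^[n] z) := fun z hz n =>
    hfT.differentiableAt (hT.mem_nhds (hXT (hfX.iterate n hz)))
  have hiter : ∀ n ω, ∃ ω', f^[2 * n] (e ω) = e ω' := by
    intro n
    induction n with
    | zero => exact fun ω => ⟨ω, rfl⟩
    | succ n ih =>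
      intro ω
      obtain ⟨ω', h⟩ := ih fun n => ω (n + 1)
      refine ⟨ω', ?_⟩
      rw [← h, mul_add, Function.iterate_add_apply, ← hshift]
      rfl
  have hpow : ∀ n ω, (2 : ℝ) ^ n ≤ ‖deriv f^[2 * n] (e ω)‖ := by
    intro n
    induction n with
    | zero => intro ω; simp
    | succ n ih =>
      intro ω
      rw [mul_add, deriv_iterate_add (hdX _ (Or.inl ⟨ω, rfl⟩)), norm_mul, pow_succ]
      have h2 : f^[2 * 1] (e ω) = e fun n => ω (n + 1) := hshift ω
      rw [h2]
      exact mul_le_mul (ih _) (hexp ω) (by norm_num) (norm_nonneg _)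
  have hder : ContinuousOn (fun z => ‖deriv f z‖) (range e) := by
    refine ((hfT.deriv hT).continuousOn.mono ?_).norm
    rintro _ ⟨ω, rfl⟩; exact heT ω
  have hder0 : ∀ z ∈ range e, 0 < ‖deriv f z‖ := by
    rintro _ ⟨ω, rfl⟩
    rw [norm_pos_iff]
    intro h0
    have h1 := deriv_iterate_add (hdX _ (Or.inl ⟨ω, rfl⟩)) 1 1
    have h2 := hexp ω
    rw [h1, Function.iterate_one, h0, mul_zero, norm_zero] at h2
    linarith
  have hne : (range e).Nonempty := range_nonempty e
  obtain ⟨zb, hzb, hb⟩ := (isCompact_range he).exists_isMinOn hne hder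
  obtain ⟨zB, hzB, hB⟩ := (isCompact_range he).exists_isMaxOn hne hder
  set b := ‖deriv f zb‖
  set B := ‖deriv f zB‖
  have hb0 : 0 < b := hder0 _ hzb
  have hB0 : 0 < B := hder0 _ hzB
  have hbB : b ≤ B := hB hzb
  -- On the second piece, factoring the derivative of `f^[2n+1]` at `e ω` in two ways loses only the
  -- ratio of extreme values of `‖deriv f‖` on the first piece.
  have hgrow : ∀ z ∈ X, ∀ n, b / B * 2 ^ n ≤ ‖deriv f^[2 * n] z‖ := by
    rintro _ (⟨ω, rfl⟩ | ⟨ω, rfl⟩) n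
    · refine le_trans ?_ (hpow n ω)
      exact mul_le_of_le_one_left (by positivity) ((div_le_one hB0).2 hbB)
    · have hd := hdX _ (Or.inl ⟨ω, rfl⟩)
      have h1 := deriv_iterate_add hd (2 * n) 1
      have h2 := deriv_iterate_add hd 1 (2 * n)
      rw [add_comm 1, h1, Function.iterate_one] at h2
      obtain ⟨ω', hω'⟩ := hiter n ω
      rw [hω'] at h2
      have h3 := congrArg norm h2
      rw [norm_mul, norm_mul] at h3
      have h4 : ‖deriv f (e ω)‖ ≤ B := hB ⟨ω, rfl⟩
      have h5 : b ≤ ‖deriv f (e ω')‖ := hb ⟨ω', rfl⟩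
      have h6 : b * 2 ^ n ≤ ‖deriv f (e ω')‖ * ‖deriv f^[2 * n] (e ω)‖ :=
        mul_le_mul h5 (hpow n ω) (by positivity) (norm_nonneg _)
      have h7 : ‖deriv f^[2 * n] (f (e ω))‖ * ‖deriv f (e ω)‖ ≤
          ‖deriv f^[2 * n] (f (e ω))‖ * B := by gcongr
      rw [div_mul_eq_mul_div, div_le_iff₀ hB0]
      linarith
  have hlim : Tendsto (fun n : ℕ => b / B * 2 ^ n) atTop atTop :=
    (tendsto_pow_atTop_atTop_of_one_lt one_lt_two).const_mul_atTop (by positivity)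
  obtain ⟨M, hM⟩ := hcantor.isCompact.isBounded.exists_norm_le
  refine ⟨hcantor, fun z hz => ?_, ?_, ?_, ?_⟩
  · exact mem_juliaSet_of_tendsto_deriv hf (M := M) (k := fun n => 2 * n)
      (fun n => hM _ (hfX.iterate n hz)) (tendsto_atTop_mono (hgrow z hz) hlim)
  · rw [Set.disjoint_left]
    exact fun z hz => notMem_poles_of_analyticAt (hfT.analyticAt (hT.mem_nhds (hXT hz)))
  · refine Subset.antisymm hfX.image_subset ?_
    rintro _ (⟨ω, rfl⟩ | ⟨ω, rfl⟩)
    -- Prepending any letter to `ω` produces a preimage.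
    · obtain ⟨i⟩ : Nonempty ι := inferInstance
      refine ⟨f (e (fun n => n.casesOn i ω)), Or.inr ⟨_, rfl⟩, ?_⟩
      rw [hshift]
    · exact ⟨e ω, Or.inl ⟨ω, rfl⟩, rfl⟩
  · obtain ⟨n, hn1, hn2⟩ := ((hlim.eventually_gt_atTop 1).and (eventually_ge_atTop 1)).exists
    exact ⟨2 * n, by omega, fun z hz => hn1.trans_le (hgrow z hz n)⟩

end Repeller

theorem subset_boundedOrbitJuliaSet {f : ℂ → ℂ} {X : Set ℂ} (hX : IsExpandingCantorRepeller f X) :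
    X ⊆ boundedOrbitJuliaSet f := by
  have hm : MapsTo f X X := fun z hz => hX.invariant ▸ mem_image_of_mem f hz
  refine fun z hz => ⟨hX.subset_juliaSet hz, fun n h => ?_, ?_⟩
  · exact Set.disjoint_left.1 hX.disjoint_poles (hm.iterate n hz) h
  · exact hX.isCantorSet.isCompact.isBounded.subset
      (by rintro _ ⟨n, rfl⟩; exact hm.iterate n hz)

/-! ### Logarithmic coordinates on a half-plane -/

theorem isOpen_lt_re (R : ℝ) : IsOpen {z : ℂ | R < z.re} :=
  isOpen_lt continuous_const Complex.continuous_re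

theorem ball_subset_lt_re {R : ℝ} {z : ℂ} (hz : 2 * R ≤ z.re) :
    ball z (z.re / 2) ⊆ {z : ℂ | R < z.re} := by
  intro w hw
  rw [mem_ball, dist_eq_norm] at hw
  have h := (abs_lt.1 ((Complex.abs_re_le_norm (w - z)).trans_lt hw)).1
  rw [Complex.sub_re] at h
  simp only [mem_ofPred_eq]
  linarith

/-- The geometry of a univalent logarithmic coordinate `L` far to the right: `L` contracts
strongly (factor `ε`) and it is almost affine on discs of radius `M`. -/
structure IsTame (L : ℂ → ℂ) (R ε M : ℝ) : Prop where
  differentiableAt : ∀ z : ℂ, R ≤ z.re → DifferentiableAt ℂ L z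
  deriv_ne_zero : ∀ z : ℂ, R ≤ z.re → deriv L z ≠ 0
  norm_deriv_le : ∀ z : ℂ, R ≤ z.re → ‖deriv L z‖ ≤ ε
  norm_sub_le : ∀ x y : ℂ, R ≤ x.re → R ≤ y.re → ‖L x - L y‖ ≤ ε * ‖x - y‖
  norm_sub_le_deriv : ∀ z : ℂ, R ≤ z.re → ∀ x ∈ ball z M, ∀ y ∈ ball z M,
    ‖L x - L y‖ ≤ 3 / 2 * ‖deriv L z‖ * ‖x - y‖
  le_norm_sub : ∀ z : ℂ, R ≤ z.re → ∀ x ∈ ball z M, ∀ y ∈ ball z M,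
    ‖deriv L z‖ / 2 * ‖x - y‖ ≤ ‖L x - L y‖

/-- The disc of radius `Re z / 2` about `z` lies in the half-plane once `Re z ≥ 2R`. Hence `|L'(z)|
≤ 1024 / Re z` and distortion is controlled at radius `Re z / 2^31`; both improve to the right. -/
theorem exists_isTame {L : ℂ → ℂ} {R : ℝ} (hR : 0 < R)
    (hL : DifferentiableOn ℂ L {z | R < z.re})
    (hinj : InjOn (fun z => Complex.exp (L z)) {z | R < z.re}) {ε M : ℝ} (hε : 0 < ε) :
    ∃ R₁, R < R₁ ∧ IsTame L R₁ ε M := by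
  have hinjL : InjOn L {z | R < z.re} := fun x hx y hy h => hinj hx hy (by simp only [h])
  set R₁ := max (2 * R) (max (1024 / ε) (2 ^ 31 * M)) with hR₁
  have h1 : 2 * R ≤ R₁ := le_max_left _ _
  have h2 : 1024 / ε ≤ R₁ := (le_max_left _ _).trans (le_max_right _ _)
  have h3 : 2 ^ 31 * M ≤ R₁ := (le_max_right _ _).trans (le_max_right _ _)
  have hdiff : ∀ z : ℂ, R₁ ≤ z.re → DifferentiableAt ℂ L z := fun z hz =>
    hL.differentiableAt ((isOpen_lt_re R).mem_nhds (show R < z.re by linarith))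
  have hder : ∀ z : ℂ, R₁ ≤ z.re → ‖deriv L z‖ ≤ ε := by
    intro z hz
    have hzp : 0 < z.re := by linarith
    have hsub := ball_subset_lt_re (h1.trans hz)
    have := norm_deriv_le_of_injOn_exp (by linarith) (hL.mono hsub) (hinj.mono hsub)
    refine this.trans ?_
    rw [div_le_iff₀ hε] at h2
    rw [div_le_iff₀ (by linarith)]
    nlinarith
  have hball : ∀ z : ℂ, R₁ ≤ z.re → ball z M ⊆ ball z (z.re / 2 / 2 ^ 30) := by
    intro z hz
    refine ball_subset_ball ?_
    linarith
  refine ⟨R₁, by linarith, hdiff, fun z hz => ?_, hder, ?_, ?_, ?_⟩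
  · exact deriv_ne_zero_of_injOn (isOpen_lt_re R) hL hinjL (show R < z.re by linarith)
  · intro x y hx hy
    have := (convex_halfSpace_re_ge R₁).norm_image_sub_le_of_norm_deriv_le (𝕜 := ℂ) hdiff hder hy hx
    exact this
  · intro z hz x hx y hy
    have hsub := ball_subset_lt_re (h1.trans hz)
    have hzp : 0 < z.re := by linarith
    have hsub2 : ball z (z.re / 2 / 2 ^ 30) ⊆ ball z (z.re / 2) := ball_subset_ball (by linarith)
    refine (convex_ball z (z.re / 2 / 2 ^ 30)).norm_image_sub_le_of_norm_deriv_le (𝕜 := ℂ)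
      (fun w hw => (hL.differentiableAt ((isOpen_lt_re R).mem_nhds (hsub (hsub2 hw)))))
      (fun w hw => ?_) (hball z hz hy) (hball z hz hx)
    have := norm_deriv_sub_deriv_le_of_injOn (by linarith) (hL.mono hsub) (hinjL.mono hsub) hw
    have h4 := norm_sub_norm_le (deriv L w) (deriv L z)
    linarith
  · intro z hz x hx y hy
    have hsub := ball_subset_lt_re (h1.trans hz)
    exact le_norm_sub_of_injOn (by linarith) (hL.mono hsub) (hinjL.mono hsub)
      (hball z hz hx) (hball z hz hy)

/-- The part of the variation of a slowly varying sequence which is spent inside an interval that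
the sequence crosses. -/
theorem le_sum_abs_sub_of_crossing {u : ℕ → ℝ} {a b : ℝ} {N : ℕ} (h0 : u 0 ≤ a)
    (hN : b ≤ u N) (hab : a ≤ b) (hu : ∀ k, |u (k + 1) - u k| ≤ 1) :
    b - a ≤ ∑ k ∈ (Finset.range N).filter (fun k => a - 1 ≤ u k ∧ u k ≤ b + 1),
      |u (k + 1) - u k| := by
  -- The truncation of `u` to `[a, b]` still travels from `a` to `b`, no faster than `u`, and stands
  -- still at every `k` outside the filter.
  set v : ℕ → ℝ := fun k => max a (min b (u k)) with hv
  have h1 : b - a ≤ v N - v 0 := by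
    simp only [hv]
    rw [min_eq_left hN, max_eq_right hab, max_eq_left (min_le_of_right_le h0)]
  refine h1.trans ?_
  rw [← Finset.sum_range_sub, Finset.sum_filter]
  refine Finset.sum_le_sum fun k _ => ?_
  have hk := abs_le.1 (hu k)
  split_ifs with h
  · calc v (k + 1) - v k ≤ |v (k + 1) - v k| := le_abs_self _
      _ ≤ |min b (u (k + 1)) - min b (u k)| := abs_max_sub_max_le_abs _ _ _ |>.trans' (by
          simp only [hv, max_comm a]; exact le_rfl)
      _ ≤ |u (k + 1) - u k| := by
          rw [min_comm b, min_comm b]; exact abs_min_sub_min_le_max _ _ _ _ |>.trans (by simp)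
  · rw [not_and_or, not_le, not_le] at h
    simp only [hv]
    rcases h with h | h
    · rw [max_eq_left (min_le_of_right_le (by linarith)),
        max_eq_left (min_le_of_right_le (by linarith)), sub_self]
    · rw [min_eq_left (by linarith), min_eq_left (by linarith), sub_self]

theorem exists_int_abs_add_two_pi_mul_le (x : ℝ) : ∃ j : ℤ, |x + 2 * Real.pi * j| ≤ Real.pi := by
  refine ⟨-round (x / (2 * Real.pi)), ?_⟩
  have h := abs_sub_round (x / (2 * Real.pi))
  have hp : 0 < 2 * Real.pi := by positivity
  have : x + 2 * Real.pi * ((-round (x / (2 * Real.pi)) : ℤ) : ℝ) =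
      2 * Real.pi * (x / (2 * Real.pi) - round (x / (2 * Real.pi))) := by
    push_cast; field_simp; ring
  rw [this, abs_mul, abs_of_pos hp]
  nlinarith

/-! ### Translations by periods of `exp`, the window, and inverse branches of the second iterate -/

/-- The translate `z + 4πik`. -/
noncomputable def shiftUp (k : ℕ) (z : ℂ) : ℂ := z + (4 * Real.pi * k : ℝ) * Complex.I

theorem shiftUp_sub (k : ℕ) (x y : ℂ) : shiftUp k x - shiftUp k y = x - y := by
  simp [shiftUp]

theorem re_shiftUp (k : ℕ) (z : ℂ) : (shiftUp k z).re = z.re := by simp [shiftUp]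

theorem exp_shiftUp (k : ℕ) (z : ℂ) : Complex.exp (shiftUp k z) = Complex.exp z := by
  rw [shiftUp, Complex.exp_add]
  have : ((4 * Real.pi * k : ℝ) : ℂ) * Complex.I = (2 * k : ℕ) * (2 * Real.pi * Complex.I) := by
    push_cast; ring
  rw [this, Complex.exp_nat_mul_two_pi_mul_I, mul_one]

/-- The translate `z + 2πij`. -/
noncomputable def turn (j : ℤ) (z : ℂ) : ℂ := z + (2 * Real.pi * j : ℝ) * Complex.I

theorem turn_sub (j : ℤ) (x y : ℂ) : turn j x - turn j y = x - y := by
  simp [turn]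

theorem re_turn (j : ℤ) (z : ℂ) : (turn j z).re = z.re := by simp [turn]

theorem im_turn (j : ℤ) (z : ℂ) : (turn j z).im = z.im + 2 * Real.pi * j := by simp [turn]

theorem exp_turn (j : ℤ) (z : ℂ) : Complex.exp (turn j z) = Complex.exp z := by
  rw [turn, Complex.exp_add]
  have : ((2 * Real.pi * j : ℝ) : ℂ) * Complex.I = j * (2 * Real.pi * Complex.I) := by
    push_cast; ring
  rw [this, Complex.exp_int_mul_two_pi_mul_I, mul_one]

/-- The disc of radius `300` about the real point `a + 150`, cut down to a strip in which points
are determined by their image under `shiftUp`. -/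
def window (a : ℝ) : Set ℂ := closedBall ((a + 150 : ℝ) : ℂ) 300 ∩ {z | |z.im| ≤ 5}

theorem isCompact_window (a : ℝ) : IsCompact (window a) :=
  (isCompact_closedBall _ _).inter_right
    (isClosed_le (continuous_abs.comp Complex.continuous_im) continuous_const)

theorem center_mem_window (a : ℝ) : ((a + 150 : ℝ) : ℂ) ∈ window a :=
  ⟨mem_closedBall_self (by norm_num), by
    change |(((a + 150 : ℝ) : ℂ)).im| ≤ 5
    rw [Complex.ofReal_im]; norm_num⟩

theorem abs_re_sub_le_of_mem_window {a : ℝ} {z : ℂ} (hz : z ∈ window a) :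
    |z.re - (a + 150)| ≤ 300 := by
  have h := (Complex.abs_re_le_norm (z - ((a + 150 : ℝ) : ℂ))).trans (mem_closedBall_iff_norm.1 hz.1)
  rwa [Complex.sub_re, Complex.ofReal_re] at h

theorem norm_sub_le_of_mem_window {a : ℝ} {x y : ℂ} (hx : x ∈ window a) (hy : y ∈ window a) :
    ‖x - y‖ ≤ 600 := by
  have h := dist_triangle_right x y ((a + 150 : ℝ) : ℂ)
  rw [dist_eq_norm] at h
  linarith [mem_closedBall.1 hx.1, mem_closedBall.1 hy.1]

/-- The window has height at most 10, less than `4π`, so its translates are disjoint. The spacing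
`2π` would be too small. -/
theorem shiftUp_injOn_window {a : ℝ} {x y : ℂ} (hx : x ∈ window a) (hy : y ∈ window a)
    {k l : ℕ} (h : shiftUp k x = shiftUp l y) : k = l ∧ x = y := by
  have hkl : k = l := by
    have h1 := congrArg Complex.im h
    simp only [shiftUp, Complex.add_im, Complex.im_ofReal_mul,
      Complex.I_im, mul_one] at h1
    have hx' := abs_le.1 (show |x.im| ≤ 5 from hx.2)
    have hy' := abs_le.1 (show |y.im| ≤ 5 from hy.2)
    have hπ := Real.pi_gt_three
    by_contra hne
    rcases Nat.lt_or_gt_of_ne hne with hlt | hlt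
    · have h2 : (k : ℝ) + 1 ≤ l := by exact_mod_cast hlt
      nlinarith
    · have h2 : (l : ℝ) + 1 ≤ k := by exact_mod_cast hlt
      nlinarith
  refine ⟨hkl, ?_⟩
  have := shiftUp_sub k x y
  rw [h, hkl, sub_self] at this
  exact (sub_eq_zero.1 this.symm)

/-- One inverse branch of the second iterate, in logarithmic coordinates. -/
noncomputable def branch (L : ℂ → ℂ) (j l : ℕ → ℤ) (k : ℕ) (z : ℂ) : ℂ :=
  turn (l k) (L (turn (j k) (L (shiftUp k z))))

theorem tendsto_re_of_mul_I {L : ℂ → ℂ} {c : ℝ}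
    (h : Tendsto (fun y : ℝ => (L (c + y * Complex.I)).re) atTop atTop) :
    Tendsto (fun k : ℕ => (L (shiftUp k c)).re) atTop atTop := by
  have h1 : Tendsto (fun k : ℕ => 4 * Real.pi * (k : ℝ)) atTop atTop :=
    tendsto_natCast_atTop_atTop.const_mul_atTop (by positivity)
  exact h.comp h1

/-- The Lipschitz bound gives slope at most `1/8`, and for large `s` the additive constant is
absorbed. Conversely, a point sent near the window must start well to its right. -/
theorem exists_re_le_div_four {L : ℂ → ℂ} {R ε M : ℝ} (hR : 0 < R) (h : IsTame L R ε M)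
    (hε : ε ≤ 1 / 8) : ∃ s₁, R ≤ s₁ ∧ ∀ s : ℝ, s₁ ≤ s → (L s).re ≤ s / 4 := by
  refine ⟨max R (8 * |(L R).re|), le_max_left _ _, fun s hs => ?_⟩
  have h1 : R ≤ s := (le_max_left _ _).trans hs
  have h2 : 8 * |(L R).re| ≤ s := (le_max_right _ _).trans hs
  have h3 := h.norm_sub_le s R (by simpa using h1) (by simp)
  have h4 := (Complex.re_le_norm _).trans h3
  rw [Complex.sub_re, ← Complex.ofReal_sub, Complex.norm_real, Real.norm_eq_abs,
    abs_of_nonneg (by linarith)] at h4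
  have h5 := le_abs_self (L R).re
  nlinarith

/-- **The inverse branches of the second iterate.** Far enough to the right there are finitely
many branches mapping a window into itself, whose contraction ratios add up to more than `1`. -/
theorem exists_branches {L : ℂ → ℂ} {R ε : ℝ} (hR : 0 < R) (hε0 : 0 < ε) (hε : ε ≤ 1 / 1202)
    (hL : IsTame L R ε 2000) (hre : Tendsto (fun s : ℝ => (L s).re) atTop atTop)
    (him : ∀ x : ℝ, R ≤ x → Tendsto (fun y : ℝ => (L (x + y * Complex.I)).re) atTop atTop) :
    ∃ (a : ℝ) (s : Finset ℕ) (j l : ℕ → ℤ) (q : ℕ → ℝ), R + 1000 ≤ a ∧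
      (1 < ∑ k ∈ s, q k) ∧
      ∀ k ∈ s, (0 < q k ∧ q k ≤ ε) ∧ MapsTo (branch L j l k) (window a) (window a) ∧
        (∀ x ∈ window a, 2 * a ≤ (L (shiftUp k x)).re) ∧
        ∀ x ∈ window a, ∀ y ∈ window a, q k * ‖x - y‖ ≤ ‖branch L j l k x - branch L j l k y‖ := by
  obtain ⟨s₁, hs₁R, hs₁⟩ := exists_re_le_div_four hR hL (by linarith)
  set a := s₁ + 1000 with ha
  set c : ℝ := a + 150 with hc
  have hcR : ∀ k : ℕ, R ≤ (shiftUp k c).re := fun k => by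
    rw [re_shiftUp, Complex.ofReal_re]; linarith
  set r : ℕ → ℝ := fun k => (L (shiftUp k c)).re with hr
  choose j hj using fun k => exists_int_abs_add_two_pi_mul_le (L (shiftUp k c)).im
  set η : ℕ → ℂ := fun k => turn (j k) (L (shiftUp k c)) with hη
  choose l hl using fun k => exists_int_abs_add_two_pi_mul_le (L (η k)).im
  -- Up to a bounded error, `u k` is the real part to which the `k`-th branch sends the window; the
  -- maximum keeps the argument in the domain and is inactive for the selected `k`.
  set u : ℕ → ℝ := fun k => (L ((max (r k) s₁ : ℝ) : ℂ)).re with hu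
  have hπ3 := Real.pi_gt_three
  have hπ4 := Real.pi_lt_d2
  have hLreal : ∀ x y : ℝ, R ≤ x → R ≤ y → |(L x).re - (L y).re| ≤ ε * |x - y| := by
    intro x y hx hy
    rw [← Complex.sub_re]
    refine (Complex.abs_re_le_norm _).trans ?_
    have := hL.norm_sub_le x y (by simpa using hx) (by simpa using hy)
    rwa [← Complex.ofReal_sub, Complex.norm_real, Real.norm_eq_abs] at this
  have hstep : ∀ k, ‖shiftUp (k + 1) (c : ℂ) - shiftUp k c‖ = 4 * Real.pi := by
    intro k
    have : shiftUp (k + 1) (c : ℂ) - shiftUp k c = ((4 * Real.pi : ℝ) : ℂ) * Complex.I := by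
      simp only [shiftUp]; push_cast; ring
    rw [this, norm_mul, Complex.norm_I, mul_one, Complex.norm_real, Real.norm_eq_abs,
      abs_of_pos (by positivity)]
  have hrstep : ∀ k, |r (k + 1) - r k| ≤ ‖L (shiftUp (k + 1) c) - L (shiftUp k c)‖ := fun k => by
    simp only [hr]
    rw [← Complex.sub_re]; exact Complex.abs_re_le_norm _
  have hrstep1 : ∀ k, |r (k + 1) - r k| ≤ 1 := by
    intro k
    refine (hrstep k).trans ((hL.norm_sub_le _ _ (hcR _) (hcR _)).trans ?_)
    rw [hstep]; nlinarith
  have hmaxstep : ∀ k, |max (r (k + 1)) s₁ - max (r k) s₁| ≤ |r (k + 1) - r k| := fun k =>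
    abs_max_sub_max_le_abs _ _ _
  have hustep : ∀ k, |u (k + 1) - u k| ≤ 1 := by
    intro k
    refine (hLreal _ _ (hs₁R.trans (le_max_right _ _)) (hs₁R.trans (le_max_right _ _))).trans ?_
    have := (hmaxstep k).trans (hrstep1 k)
    nlinarith [abs_nonneg (max (r (k + 1)) s₁ - max (r k) s₁)]
  have hu0 : u 0 ≤ a := by
    have h0 : r 0 ≤ c / 4 := by
      have : shiftUp 0 (c : ℂ) = c := by simp [shiftUp]
      simp only [hr, this]
      exact hs₁ c (by linarith)
    refine (hs₁ _ (le_max_right _ _)).trans ?_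
    have : max (r 0) s₁ ≤ 4 * a := max_le (by linarith) (by linarith)
    linarith
  have hulim : Tendsto u atTop atTop :=
    hre.comp (tendsto_atTop_mono (fun k => le_max_left _ _)
      (tendsto_re_of_mul_I (him c (by linarith))))
  obtain ⟨N, hN⟩ := (hulim.eventually_ge_atTop (a + 300)).exists
  -- `u` moves from at most `a` to at least `a + 300` in steps of size at most 1, so the steps
  -- starting in `[a - 1, a + 301]` have total length at least 300.
  have hcross := le_sum_abs_sub_of_crossing hu0 hN (by linarith) hustep
  set S := (Finset.range N).filter (fun k => a - 1 ≤ u k ∧ u k ≤ a + 300 + 1) with hS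
  have hrS : ∀ k ∈ S, 4 * (a - 1) ≤ r k ∧ u k = (L (r k : ℂ)).re := by
    intro k hk
    have h1 := (Finset.mem_filter.1 hk).2.1
    have h2 := hs₁ _ (le_max_right (r k) s₁)
    have h3 : 4 * (a - 1) ≤ max (r k) s₁ := by linarith
    rcases le_max_iff.1 h3 with h | h
    · exact ⟨h, by simp only [hu]; rw [max_eq_left (by linarith)]⟩
    · linarith
  have hηre : ∀ k, (η k).re = r k := fun k => re_turn _ _
  have hηim : ∀ k, |(η k).im| ≤ Real.pi := fun k => by simp only [hη]; rw [im_turn]; exact hj k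
  have hηr : ∀ k, ‖η k - (r k : ℂ)‖ ≤ Real.pi := by
    intro k
    have : η k - (r k : ℂ) = ((η k).im : ℂ) * Complex.I := by
      apply Complex.ext <;> simp [hηre]
    rw [this, norm_mul, Complex.norm_I, mul_one, Complex.norm_real, Real.norm_eq_abs]
    exact hηim k
  -- The divisor 4 is the product of the two lower distortion factors `1/2`. The upper factors `3/2`
  -- and the spacing `4π` bound a step of `u` by `(3/2)^2 * 4π * 4 = 36π` times `q k`.
  set q : ℕ → ℝ := fun k => ‖deriv L (shiftUp k c)‖ * ‖deriv L (η k)‖ / 4 with hq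
  have hqu : ∀ k ∈ S, |u (k + 1) - u k| ≤ 36 * Real.pi * q k := by
    intro k hk
    obtain ⟨h1, h2⟩ := hrS k hk
    have hd := abs_le.1 (hrstep1 k)
    have h3 : u (k + 1) = (L (r (k + 1) : ℂ)).re := by
      simp only [hu]; rw [max_eq_left (by linarith)]
    have h4 : ‖L (shiftUp (k + 1) c) - L (shiftUp k c)‖ ≤
        3 / 2 * ‖deriv L (shiftUp k c)‖ * (4 * Real.pi) := by
      rw [← hstep k]
      refine hL.norm_sub_le_deriv _ (hcR k) _ ?_ _ (mem_ball_self (by norm_num))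
      rw [mem_ball, dist_eq_norm, hstep]; linarith
    have h5 : ‖L (r (k + 1) : ℂ) - L (r k : ℂ)‖ ≤ 3 / 2 * ‖deriv L (η k)‖ * |r (k + 1) - r k| := by
      have := hL.norm_sub_le_deriv (η k) (by rw [hηre]; linarith) (r (k + 1)) (by
        rw [mem_ball, dist_eq_norm]
        calc ‖(r (k + 1) : ℂ) - η k‖ = ‖((r (k + 1) - r k : ℝ) : ℂ) - (η k - r k)‖ := by
              congr 1; push_cast; ring
          _ ≤ ‖((r (k + 1) - r k : ℝ) : ℂ)‖ + ‖η k - r k‖ := norm_sub_le _ _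
          _ ≤ 1 + Real.pi := by
              rw [Complex.norm_real, Real.norm_eq_abs]
              exact add_le_add (hrstep1 k) (hηr k)
          _ < 2000 := by linarith) (r k) (by
        rw [mem_ball, dist_eq_norm, norm_sub_rev]; linarith [hηr k])
      rwa [← Complex.ofReal_sub, Complex.norm_real, Real.norm_eq_abs] at this
    rw [h2, h3, ← Complex.sub_re]
    refine (Complex.abs_re_le_norm _).trans (h5.trans ?_)
    calc 3 / 2 * ‖deriv L (η k)‖ * |r (k + 1) - r k| ≤
        3 / 2 * ‖deriv L (η k)‖ * (3 / 2 * ‖deriv L (shiftUp k c)‖ * (4 * Real.pi)) := by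
          gcongr; exact (hrstep k).trans h4
      _ = 36 * Real.pi * q k := by simp only [hq]; ring
  -- The crossing length 300 exceeds `36π`.
  have hsum : 1 < ∑ k ∈ S, q k := by
    have h1 : a + 300 - a ≤ 36 * Real.pi * ∑ k ∈ S, q k := by
      rw [Finset.mul_sum]
      exact hcross.trans (Finset.sum_le_sum hqu)
    by_contra! hle
    nlinarith
  refine ⟨a, S, j, l, q, by linarith, hsum, fun k hk => ?_⟩
  obtain ⟨h1, h2⟩ := hrS k hk
  have hηR : R ≤ (η k).re := by rw [hηre]; linarith
  have hwball : ∀ x ∈ window a, ‖shiftUp k x - shiftUp k c‖ ≤ 300 := fun x hx => by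
    rw [shiftUp_sub]; exact mem_closedBall_iff_norm.1 hx.1
  have hwR : ∀ x ∈ window a, R ≤ (shiftUp k x).re := fun x hx => by
    rw [re_shiftUp]
    linarith [(abs_le.1 (abs_re_sub_le_of_mem_window hx)).1]
  have hin : ∀ x ∈ window a, ‖turn (j k) (L (shiftUp k x)) - η k‖ ≤ 1 := fun x hx => by
    simp only [hη]
    rw [turn_sub]
    refine (hL.norm_sub_le _ _ (hwR x hx) (hcR k)).trans ?_
    nlinarith [hwball x hx, norm_nonneg (shiftUp k x - shiftUp k c)]
  have hinre : ∀ x ∈ window a, r k - 1 ≤ (L (shiftUp k x)).re := fun x hx => by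
    have := (abs_le.1 ((Complex.abs_re_le_norm _).trans (hin x hx))).1
    rw [Complex.sub_re, re_turn, hηre] at this
    linarith
  have hinR : ∀ x ∈ window a, R ≤ (turn (j k) (L (shiftUp k x))).re := fun x hx => by
    rw [re_turn]; linarith [hinre x hx]
  have hdc := hL.norm_deriv_le _ (hcR k)
  have hdη := hL.norm_deriv_le _ hηR
  have hdc0 := norm_pos_iff.2 (hL.deriv_ne_zero _ (hcR k))
  have hdη0 := norm_pos_iff.2 (hL.deriv_ne_zero _ hηR)
  refine ⟨⟨by simp only [hq]; positivity, ?_⟩, fun x hx => ?_, fun x hx => ?_,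
    fun x hx y hy => ?_⟩
  · simp only [hq]
    nlinarith
  -- Since `|u k - c| ≤ 151`, two errors of size 1 leave the real part within 153 of `c`; the
  -- imaginary part is at most `π + 1 < 5`.
  · have h3 : ‖branch L j l k x - turn (l k) (L (η k))‖ ≤ 1 := by
      rw [branch, turn_sub]
      refine (hL.norm_sub_le _ _ (hinR x hx) hηR).trans ?_
      nlinarith [hin x hx, norm_nonneg (turn (j k) (L (shiftUp k x)) - η k)]
    have h4 : |(turn (l k) (L (η k))).re - u k| ≤ 1 := by
      rw [re_turn, h2, ← Complex.sub_re]
      refine (Complex.abs_re_le_norm _).trans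
        ((hL.norm_sub_le _ _ hηR (by rw [Complex.ofReal_re]; linarith)).trans ?_)
      nlinarith [hηr k, norm_nonneg (η k - r k)]
    have h5 : |(turn (l k) (L (η k))).im| ≤ Real.pi := by rw [im_turn]; exact hl k
    have h6 := (Finset.mem_filter.1 hk).2
    have h7 : |(branch L j l k x).im| ≤ 5 := by
      have := (Complex.abs_im_le_norm _).trans h3
      rw [Complex.sub_im] at this
      have h8 := abs_le.1 this
      have h9 := abs_le.1 h5
      rw [abs_le]
      constructor <;> linarith
    have h8 : |(branch L j l k x).re - c| ≤ 153 := by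
      have := (Complex.abs_re_le_norm _).trans h3
      rw [Complex.sub_re] at this
      have h8 := abs_le.1 this
      have h9 := abs_le.1 h4
      rw [abs_le]
      constructor <;> linarith
    refine ⟨mem_closedBall_iff_norm.2 ((Complex.norm_le_abs_re_add_abs_im _).trans ?_), h7⟩
    rw [Complex.sub_re, Complex.sub_im, Complex.ofReal_re, Complex.ofReal_im, sub_zero]
    linarith
  · linarith [hinre x hx]
  · rw [branch, branch, turn_sub]
    have h3 := hL.le_norm_sub (η k) hηR _
      (mem_ball_iff_norm.2 ((hin x hx).trans_lt (by norm_num))) _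
      (mem_ball_iff_norm.2 ((hin y hy).trans_lt (by norm_num)))
    have h4 := hL.le_norm_sub (shiftUp k c) (hcR k) _
      (mem_ball_iff_norm.2 ((hwball x hx).trans_lt (by norm_num))) _
      (mem_ball_iff_norm.2 ((hwball y hy).trans_lt (by norm_num)))
    rw [shiftUp_sub] at h4
    rw [turn_sub] at h3
    calc q k * ‖x - y‖ = ‖deriv L (η k)‖ / 2 * (‖deriv L (shiftUp k c)‖ / 2 * ‖x - y‖) := by
          simp only [hq]; ring
      _ ≤ ‖deriv L (η k)‖ / 2 * ‖L (shiftUp k x) - L (shiftUp k y)‖ := by gcongr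
      _ ≤ _ := h3

theorem branch_contracts {L : ℂ → ℂ} {R ε M a : ℝ} (hε0 : 0 < ε) (hε : ε ≤ 1 / 1202)
    (hL : IsTame L R ε M) (ha : R + 1000 ≤ a) (haR : 0 < R) {j l : ℕ → ℤ} {k : ℕ}
    (hin : ∀ x ∈ window a, 2 * a ≤ (L (shiftUp k x)).re) :
    (∀ x ∈ window a, ∀ y ∈ window a,
      ‖branch L j l k x - branch L j l k y‖ ≤ 1 / 1202 * ‖x - y‖) ∧
    ∀ x ∈ window a, ∃ d, HasDerivAt (branch L j l k) d x ∧ ‖d‖ ≤ ε := by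
  have hwR : ∀ x ∈ window a, R ≤ (shiftUp k x).re := fun x hx => by
    rw [re_shiftUp]
    linarith [(abs_le.1 (abs_re_sub_le_of_mem_window hx)).1]
  have hinR : ∀ x ∈ window a, R ≤ (turn (j k) (L (shiftUp k x))).re := fun x hx => by
    rw [re_turn]; linarith [hin x hx]
  refine ⟨fun x hx y hy => ?_, fun x hx => ?_⟩
  · rw [branch, branch, turn_sub]
    have h1 := hL.norm_sub_le _ _ (hinR x hx) (hinR y hy)
    have h2 := hL.norm_sub_le _ _ (hwR x hx) (hwR y hy)
    rw [turn_sub] at h1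
    rw [shiftUp_sub] at h2
    have := norm_nonneg (x - y)
    calc _ ≤ _ := h1
      _ ≤ 1 * ‖L (shiftUp k x) - L (shiftUp k y)‖ := by gcongr; linarith
      _ ≤ ε * ‖x - y‖ := by rw [one_mul]; exact h2
      _ ≤ _ := by gcongr
  · have h1 := (hL.differentiableAt _ (hwR x hx)).hasDerivAt
    have h2 := (hL.differentiableAt _ (hinR x hx)).hasDerivAt
    have h3 : HasDerivAt (shiftUp k) 1 x := (hasDerivAt_id x).add_const _
    have h4 : HasDerivAt (fun z => turn (j k) (L (shiftUp k z))) (deriv L (shiftUp k x) * 1) x :=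
      (h1.comp x h3).add_const _
    have h5 : HasDerivAt (branch L j l k)
        (deriv L (turn (j k) (L (shiftUp k x))) * (deriv L (shiftUp k x) * 1)) x :=
      (h2.comp x h4).add_const _
    refine ⟨_, h5, ?_⟩
    rw [norm_mul, mul_one]
    have h6 := hL.norm_deriv_le _ (hwR x hx)
    have h7 := hL.norm_deriv_le _ (hinR x hx)
    nlinarith [norm_nonneg (deriv L (shiftUp k x)),
      norm_nonneg (deriv L (turn (j k) (L (shiftUp k x))))]

theorem half_norm_sub_le_norm_exp_sub {x y : ℂ} {m : ℝ} (hy : m ≤ y.re) (h : ‖x - y‖ ≤ 1 / 2) :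
    Real.exp m / 2 * ‖x - y‖ ≤ ‖Complex.exp x - Complex.exp y‖ := by
  have h1 : Complex.exp x - Complex.exp y = Complex.exp y * (Complex.exp (x - y) - 1) := by
    rw [mul_sub, ← Complex.exp_add]; simp
  have h2 := Complex.norm_exp_sub_one_sub_id_le (x := x - y) (by linarith)
  have h3 := norm_sub_norm_le (x - y) ((x - y) - (Complex.exp (x - y) - 1))
  rw [sub_sub_cancel, norm_sub_rev (x - y) (Complex.exp (x - y) - 1)] at h3
  have h4 : ‖x - y‖ / 2 ≤ ‖Complex.exp (x - y) - 1‖ := by nlinarith [norm_nonneg (x - y)]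
  rw [h1, norm_mul, Complex.norm_exp]
  calc Real.exp m / 2 * ‖x - y‖ = Real.exp m * (‖x - y‖ / 2) := by ring
    _ ≤ _ := by gcongr

/-- The pairs with different first letters form a compact set, on which the distance attains a
positive minimum. -/
theorem exists_pos_le_dist_of_injective {ι : Type*} [Fintype ι] [TopologicalSpace ι]
    [DiscreteTopology ι] {ζ : (ℕ → ι) → ℂ} (hζ : Continuous ζ)
    (hinj : Function.Injective ζ) :
    ∃ δ > 0, ∀ ω ω' : ℕ → ι, ω 0 ≠ ω' 0 → δ ≤ dist (ζ ω) (ζ ω') := by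
  set P : Set ((ℕ → ι) × (ℕ → ι)) := {p | p.1 0 ≠ p.2 0} with hP
  have hclosed : IsClosed P := by
    have : Continuous fun p : (ℕ → ι) × (ℕ → ι) => (p.1 0, p.2 0) := by fun_prop
    exact (isClosed_discrete {p : ι × ι | p.1 ≠ p.2}).preimage this
  rcases P.eq_empty_or_nonempty with h | h
  · refine ⟨1, one_pos, fun ω ω' hne => ?_⟩
    have : (ω, ω') ∈ P := hne
    rw [h] at this
    exact this.elim
  · obtain ⟨p, hp, hmin⟩ := hclosed.isCompact.exists_isMinOn h
      (f := fun p : (ℕ → ι) × (ℕ → ι) => dist (ζ p.1) (ζ p.2)) (by fun_prop)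
    refine ⟨dist (ζ p.1) (ζ p.2), dist_pos.2 fun heq => hp (by rw [hinj heq]),
      fun ω ω' hne => hmin (show (ω, ω') ∈ P from hne)⟩

/-- Each common letter is peeled off at the cost of one lower Lipschitz factor. -/
theorem mul_prod_le_dist_of_first_difference {ι : Type*} {ζ : (ℕ → ι) → ℂ} {ψ : ι → ℂ → ℂ}
    (hζ : ∀ ω, ζ ω = ψ (ω 0) (ζ fun n => ω (n + 1))) {q : ι → ℝ} (hq : ∀ i, 0 ≤ q i)
    (hψ : ∀ i ω ω', q i * dist (ζ ω) (ζ ω') ≤ dist (ψ i (ζ ω)) (ψ i (ζ ω'))) {δ : ℝ}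
    (hδ : ∀ ω ω' : ℕ → ι, ω 0 ≠ ω' 0 → δ ≤ dist (ζ ω) (ζ ω')) (n : ℕ) :
    ∀ ω ω' : ℕ → ι, (∀ m < n, ω m = ω' m) → ω n ≠ ω' n →
      δ * ∏ m ∈ Finset.range n, q (ω m) ≤ dist (ζ ω) (ζ ω') := by
  induction n with
  | zero => intro ω ω' _ h; simpa using hδ ω ω' h
  | succ n ih =>
    intro ω ω' h hne
    have h1 := ih (fun n => ω (n + 1)) (fun n => ω' (n + 1)) (fun m hm => h _ (by omega)) hne
    rw [hζ ω, hζ ω', ← h 0 (by omega), Finset.prod_range_succ']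
    calc _ = q (ω 0) * (δ * ∏ m ∈ Finset.range n, q (ω (m + 1))) := by ring
      _ ≤ _ := by gcongr; exact hq _
      _ ≤ _ := hψ _ _ _

/-- A map with a univalent logarithmic coordinate on a half-plane which is unbounded along
horizontal and vertical lines has a repeller of dimension greater than one. -/
theorem exists_repeller_of_logCoordinate {f : ℂ → ℂ} (hf : MeromorphicNFOn f univ) {T : Set ℂ}
    (hT : IsOpen T) (hfT : DifferentiableOn ℂ f T) {L : ℂ → ℂ} {R : ℝ} (hR : 0 < R)
    (hL : DifferentiableOn ℂ L {z | R < z.re})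
    (hinj : InjOn (fun z => Complex.exp (L z)) {z | R < z.re})
    (hLT : ∀ z : ℂ, R < z.re → Complex.exp (L z) ∈ T)
    (hfL : ∀ z : ℂ, R < z.re → f (Complex.exp (L z)) = Complex.exp z)
    (hre : Tendsto (fun s : ℝ => (L s).re) atTop atTop)
    (him : ∀ x : ℝ, R < x → Tendsto (fun y : ℝ => (L (x + y * Complex.I)).re) atTop atTop) :
    ∃ X : Set ℂ, IsExpandingCantorRepeller f X ∧ 1 < dimH X := by
  -- Real parts in the window differ by at most 600, so passing to `exp` costs the expansion at most
  -- a factor `exp 600`; the choice leaves `‖deriv f^[2]‖ ≥ 2`.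
  set ε := Real.exp (-600) / 2 with hε
  have hε0 : 0 < ε := by positivity
  have hε1 : ε ≤ 1 / 1202 := by
    have := Real.add_one_le_exp (600 : ℝ)
    rw [hε, Real.exp_neg, div_le_div_iff₀ (by norm_num) (by norm_num), inv_mul_le_iff₀ (by positivity)]
    linarith
  obtain ⟨R₁, hRR₁, htame⟩ := exists_isTame hR hL hinj (M := 2000) hε0
  have hR₁ : 0 < R₁ := hR.trans hRR₁
  obtain ⟨a, S, j, l, q, ha, hsum, hS⟩ := exists_branches hR₁ hε0 hε1 htame hre
    fun x hx => him x (hRR₁.trans_le hx)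
  have hcontr := fun k hk => branch_contracts hε0 hε1 htame ha hR₁ (j := j) (l := l) (hS k hk).2.2.1
  obtain ⟨ζ, hζc, hζw, hζ⟩ := exists_codeMap (ι := S) (isCompact_window a)
    ⟨_, center_mem_window a⟩ (ψ := fun k => branch L j l k) (fun k => (hS k k.2).2.1)
    (fun k x hx y hy => by
      rw [dist_eq_norm, dist_eq_norm]
      have := (hcontr k k.2).1 x hx y hy
      linarith [norm_nonneg (x - y)])
  have hwin : ∀ ω, |(ζ ω).re - (a + 150)| ≤ 300 := fun ω => abs_re_sub_le_of_mem_window (hζw ω)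
  have hupR : ∀ (k : ℕ) ω, R < (shiftUp k (ζ ω)).re := fun k ω => by
    rw [re_shiftUp]; linarith [(abs_le.1 (hwin ω)).1]
  have hinRe : ∀ (k : S) ω, 2 * a ≤ (turn (j k) (L (shiftUp k (ζ ω)))).re := fun k ω => by
    rw [re_turn]; exact (hS k k.2).2.2.1 _ (hζw ω)
  have hinR : ∀ (k : S) ω, R < (turn (j k) (L (shiftUp k (ζ ω)))).re := fun k ω => by
    linarith [hinRe k ω]
  -- In the dynamical plane the turns disappear under `exp`: the first application of `f` undoes the
  -- outer `L` of a branch and the second the inner one.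
  set e : (ℕ → S) → ℂ := fun ω => Complex.exp (ζ ω) with he
  have hec : Continuous e := by fun_prop
  have heL : ∀ ω, e ω = Complex.exp (L (turn (j (ω 0)) (L (shiftUp (ω 0) (ζ fun n => ω (n + 1)))))) := by
    intro ω
    simp only [he]
    rw [hζ ω, branch, exp_turn]
  have heT : ∀ ω, e ω ∈ T := fun ω => by rw [heL]; exact hLT _ (hinR _ _)
  have hfe' : ∀ ω, f (e ω) = Complex.exp (turn (j (ω 0)) (L (shiftUp (ω 0) (ζ fun n => ω (n + 1))))) :=
    fun ω => by rw [heL]; exact hfL _ (hinR _ _)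
  have hfe : ∀ ω, f (e ω) = Complex.exp (L (shiftUp (ω 0) (ζ fun n => ω (n + 1)))) := fun ω => by
    rw [hfe', exp_turn]
  have hfeT : ∀ ω, f (e ω) ∈ T := fun ω => by rw [hfe]; exact hLT _ (hupR _ _)
  have hshift : ∀ ω, f (f (e ω)) = e fun n => ω (n + 1) := fun ω => by
    rw [hfe, hfL _ (hupR _ _), exp_shiftUp]
  have hstep : ∀ ω ω', f (e ω) = f (e ω') →
      ω 0 = ω' 0 ∧ ζ (fun n => ω (n + 1)) = ζ fun n => ω' (n + 1) := by
    intro ω ω' h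
    rw [hfe, hfe] at h
    have := hinj (hupR _ _) (hupR _ _) h
    obtain ⟨h1, h2⟩ := shiftUp_injOn_window (hζw _) (hζw _) this
    exact ⟨Subtype.ext h1, h2⟩
  have hfinj : Function.Injective fun ω => f (e ω) := by
    have key : ∀ n ω ω', f (e ω) = f (e ω') → ω n = ω' n := by
      intro n
      induction n with
      | zero => exact fun ω ω' h => (hstep ω ω' h).1
      | succ n ih =>
        intro ω ω' h
        exact ih (fun n => ω (n + 1)) (fun n => ω' (n + 1)) (by simp only [he, (hstep ω ω' h).2])
    exact fun ω ω' h => funext fun n => key n ω ω' h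
  have heinj : Function.Injective e := fun ω ω' h => hfinj (by simp only [h])
  have hζinj : Function.Injective ζ := fun ω ω' h => heinj (by simp only [he, h])
  -- The moduli differ: `log ‖e ω‖ ≤ a + 450 < 2 * a ≤ log ‖f (e ω')‖`.
  have hdisj : ∀ ω ω', e ω ≠ f (e ω') := by
    intro ω ω' h
    have h1 := congrArg norm h
    rw [hfe', he, Complex.norm_exp, Complex.norm_exp, Real.exp_eq_exp] at h1
    linarith [hinRe (ω' 0) (fun n => ω' (n + 1)), (abs_le.1 (hwin ω)).2]
  have hd : ∀ ω, 2 ≤ ‖deriv f^[2] (e ω)‖ := by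
    intro ω
    set x := ζ fun n => ω (n + 1) with hx
    set k : ℕ := Subtype.val (ω 0) with hk
    obtain ⟨d, hd, hdε⟩ := (hcontr k (ω 0).2).2 x (hζw _)
    have hζx : ζ ω = branch L j l k x := hζ ω
    have h1 : HasDerivAt (fun z => Complex.exp (branch L j l k z))
        (Complex.exp (branch L j l k x) * d) x := hd.cexp
    have h2 : DifferentiableAt ℂ f^[2] (Complex.exp (branch L j l k x)) := by
      rw [← hζx]
      exact (hfT.differentiableAt (hT.mem_nhds (hfeT ω))).comp _
        (hfT.differentiableAt (hT.mem_nhds (heT ω)))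
    have h3 := h2.hasDerivAt.comp x h1
    have hLc : ContinuousAt L (shiftUp k x) :=
      (hL.differentiableAt ((isOpen_lt_re R).mem_nhds (hupR _ _))).continuousAt
    have hc1 : ContinuousAt (shiftUp k) x := by unfold shiftUp; fun_prop
    have hc2 : ContinuousAt (fun z => turn (j k) (L (shiftUp k z))) x :=
      (ContinuousAt.comp hLc hc1).add continuousAt_const
    have h4 : (f^[2] ∘ fun z => Complex.exp (branch L j l k z)) =ᶠ[𝓝 x] Complex.exp := by
      filter_upwards [hc1.eventually_mem ((isOpen_lt_re R).mem_nhds (hupR k _)),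
        hc2.eventually_mem ((isOpen_lt_re R).mem_nhds (hinR (ω 0) _))] with z hz1 hz2
      rw [Function.comp_apply, branch, exp_turn]
      change f (f _) = _
      rw [hfL _ hz2, exp_turn, hfL _ hz1, exp_shiftUp]
    have h5 := (h3.congr_of_eventuallyEq h4.symm).unique (Complex.hasDerivAt_exp x)
    have h6 := congrArg norm h5
    rw [norm_mul, norm_mul, Complex.norm_exp, Complex.norm_exp, ← hζx] at h6
    have h7 : Real.exp (ζ ω).re ≤ Real.exp 600 * Real.exp x.re := by
      rw [← Real.exp_add, Real.exp_le_exp]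
      linarith [(abs_le.1 (hwin ω)).2, (abs_le.1 (hwin fun n => ω (n + 1))).1]
    have h8 : Real.exp 600 * ε = 1 / 2 := by
      rw [hε, Real.exp_neg]; field_simp
    have h9 : Real.exp x.re ≤ ‖deriv f^[2] (e ω)‖ * (Real.exp 600 * Real.exp x.re * ε) := by
      refine h6.symm.le.trans ?_
      simp only [he]
      gcongr
    rw [show Real.exp 600 * Real.exp x.re * ε = Real.exp x.re * (Real.exp 600 * ε) by ring, h8] at h9
    have := Real.exp_pos x.re
    by_contra! hlt
    nlinarith
  -- A single ratio is at most `ε < 1`, so a sum above 1 needs two branches.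
  have hnt : Nontrivial S := by
    rw [← not_subsingleton_iff_nontrivial]
    intro hsub
    have hcard : S.card ≤ 1 := Finset.card_le_one_iff_subsingleton_coe.2 hsub
    have h1 : ∑ k ∈ S, q k ≤ S.card • ε := Finset.sum_le_card_nsmul _ _ _ fun k hk => (hS k hk).1.2
    rw [nsmul_eq_mul] at h1
    have h2 : (S.card : ℝ) ≤ 1 := by exact_mod_cast hcard
    nlinarith
  refine ⟨_, isExpandingCantorRepeller_of_coding hf hT hfT hec heT hfeT hshift hfinj hdisj hd, ?_⟩
  have hq0 : ∀ k : S, 0 < q k := fun k => (hS k k.2).1.1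
  obtain ⟨t, ht1, ht⟩ := exists_rpow_sum_ge_one (ι := S) (q := fun k => q k) hq0
    (by rwa [Finset.sum_coe_sort S q])
  obtain ⟨δ, hδ, hδζ⟩ := exists_pos_le_dist_of_injective hζc hζinj
  have hsep := mul_prod_le_dist_of_first_difference hζ (fun k => (hq0 k).le)
    (fun k ω ω' => by
      rw [dist_eq_norm, dist_eq_norm]
      exact (hS k k.2).2.2.2 _ (hζw ω) _ (hζw ω')) hδζ
  obtain ⟨k₀⟩ : Nonempty S := inferInstance
  -- `exp` is not injective on the window. Prepending a fixed letter confines all points to a set of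
  -- diameter at most `600/1202 < 1/2`, where `exp` is bi-Lipschitz.
  set π : (ℕ → S) → ℂ := fun ω => e fun n => n.casesOn k₀ ω with hπ
  have hπζ : ∀ ω, ζ (fun n => n.casesOn k₀ ω) = branch L j l k₀ (ζ ω) := fun ω => hζ _
  have hcons : Continuous fun ω : ℕ → S => (fun n => n.casesOn k₀ ω : ℕ → S) := by
    refine continuous_pi fun n => ?_
    cases n with
    | zero => exact continuous_const
    | succ n => exact continuous_apply n
  have hdim : (t : ENNReal) ≤ dimH (range π) := by
    refine le_dimH_range_of_separated (hec.comp hcons) hq0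
      (fun k => (hS k k.2).1.2.trans_lt (by linarith)) (one_pos.trans ht1) ht
      (δ := Real.exp (a - 150) / 2 * q k₀ * δ) (by have := hq0 k₀; positivity) ?_
    intro ω ω' n h1 h2
    have h3 := hsep n ω ω' h1 h2
    have h4 := (hS k₀ k₀.2).2.2.2 _ (hζw ω) _ (hζw ω')
    have h5 := (hcontr k₀ k₀.2).1 _ (hζw ω) _ (hζw ω')
    have h6 := norm_sub_le_of_mem_window (hζw ω) (hζw ω')
    rw [← hπζ, ← hπζ] at h4 h5
    have h7 := half_norm_sub_le_norm_exp_sub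
      (x := ζ fun n => n.casesOn k₀ ω) (y := ζ fun n => n.casesOn k₀ ω') (m := a - 150)
      (by linarith [(abs_le.1 (hwin fun n => n.casesOn k₀ ω')).1]) (by linarith)
    have h8 := hq0 k₀
    rw [dist_eq_norm] at h3
    rw [dist_eq_norm]
    calc Real.exp (a - 150) / 2 * q k₀ * δ * ∏ m ∈ Finset.range n, q (ω m) =
          Real.exp (a - 150) / 2 * (q k₀ * (δ * ∏ m ∈ Finset.range n, q (ω m))) := by ring
      _ ≤ Real.exp (a - 150) / 2 * (q k₀ * ‖ζ ω - ζ ω'‖) := by gcongr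
      _ ≤ _ := by
        refine le_trans ?_ h7
        gcongr
  calc (1 : ENNReal) < t := by exact_mod_cast ht1
    _ ≤ _ := hdim
    _ ≤ _ := dimH_mono ?_
  rintro _ ⟨ω, rfl⟩
  exact Or.inl ⟨_, rfl⟩

/-! ### Parametrization of a logarithmic tract by a half-plane -/

theorem simplyConnectedSpace_lt_re (R : ℝ) : SimplyConnectedSpace {z : ℂ | R < z.re} := by
  have : ContractibleSpace {z : ℂ | R < z.re} :=
    (convex_halfSpace_re_gt R).contractibleSpace ⟨((R + 1 : ℝ) : ℂ), by simp⟩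
  infer_instance

/-- `φ` parametrizes the tract `T` of `f` by the half-plane `{R < Re z}`, with inverse `g`, in such
a way that `f ∘ φ = exp`. -/
structure IsTractParametrization (f : ℂ → ℂ) (T : Set ℂ) (R : ℝ) (φ g : ℂ → ℂ) : Prop where
  differentiableOn : DifferentiableOn ℂ φ {z | R < z.re}
  continuousOn_inverse : ContinuousOn g T
  mapsTo : MapsTo φ {z | R < z.re} T
  leftInverse : ∀ z : ℂ, R < z.re → g (φ z) = z
  apply_eq_exp : ∀ z : ℂ, R < z.re → f (φ z) = Complex.exp z

/-- Lifting `f` through `exp`, and `exp` through `f`, with matching base points gives two maps that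
are mutually inverse by uniqueness of lifts. -/
theorem exists_isTractParametrization {f : ℂ → ℂ} {T : Set ℂ} (hT : IsOpen T)
    (hsc : SimplyConnectedSpace T) {R₀ : ℝ} (hR₀ : 0 < R₀) (hf : DifferentiableOn ℂ f T)
    (h : MapsTo f T {w | R₀ < ‖w‖}) (hcov : IsCoveringMap (h.restrict f T {w | R₀ < ‖w‖})) :
    ∃ φ g, IsTractParametrization f T (Real.log R₀) φ g := by
  set H := {z : ℂ | Real.log R₀ < z.re} with hH
  have hexpH : ∀ z : ℂ, z ∈ H ↔ R₀ < ‖Complex.exp z‖ := fun z => by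
    rw [Complex.norm_exp, hH, mem_ofPred_eq, Real.log_lt_iff_lt_exp hR₀]
  have hf0 : ∀ z ∈ T, f z ≠ 0 := fun z hz h0 => by
    have := h hz
    rw [h0, mem_ofPred_eq, norm_zero] at this
    linarith
  obtain ⟨g, hgc, hge⟩ := Complex.exists_continuousOn_eqOn_exp_comp (U := T) hsc hT hf.continuousOn
    (by rintro ⟨z, hz, h0⟩; exact hf0 z hz h0)
  have hge' : ∀ z ∈ T, Complex.exp (g z) = f z := hge
  have hgd := differentiableOn_of_exp_comp hT hgc hf hge
  have hgH : ∀ z ∈ T, g z ∈ H := fun z hz => by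
    rw [hexpH, hge' z hz]; exact h hz
  obtain ⟨e₀⟩ : Nonempty T := inferInstance
  have := simplyConnectedSpace_lt_re (Real.log R₀)
  have : LocallyPathConnectedSpace H := (isOpen_lt_re _).locallyPathConnectedSpace
  obtain ⟨F, ⟨hF0, hF⟩, -⟩ := hcov.existsUnique_continuousMap_lifts
    (A := H) ⟨fun z => ⟨Complex.exp z, (hexpH z).1 z.2⟩, by fun_prop⟩ ⟨g e₀, hgH _ e₀.2⟩ e₀
    (Subtype.ext (hge' e₀ e₀.2).symm)
  have hFf : ∀ z : H, f (F z) = Complex.exp z := fun z => congrArg Subtype.val (congrFun hF z)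
  have hgF : ∀ z : H, g (F z) = z := by
    have h1 : Continuous fun z : H => g (F z) :=
      hgc.comp_continuous (by fun_prop) fun z => (F z).2
    have h2 := Complex.isCoveringMap_exp.eq_of_comp_eq h1 continuous_subtype_val (by
      ext z
      simp only [Function.comp_apply]
      rw [hge' _ (F z).2, hFf]) ⟨g e₀, hgH _ e₀.2⟩ (by simp only [hF0])
    exact fun z => congrFun h2 z
  have hFg : ∀ z : T, F ⟨g z, hgH z z.2⟩ = z := by
    have h1 : Continuous fun z : T => F ⟨g z, hgH z z.2⟩ :=
      F.continuous.comp ((continuousOn_iff_continuous_domRestrict.1 hgc).subtype_mk _)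
    have h2 := hcov.eq_of_comp_eq h1 continuous_id (by
      ext z
      simp only [Function.comp_apply, id, MapsTo.val_restrict_apply]
      rw [hFf, hge' z z.2]) e₀ (by simp only [hF0, id])
    exact fun z => congrFun h2 z
  have hginj : InjOn g T := fun x hx y hy hxy => by
    have h1 := hFg ⟨x, hx⟩
    have h2 := hFg ⟨y, hy⟩
    simp only [hxy] at h1
    exact congrArg Subtype.val (h1.symm.trans h2)
  have hφ : ∀ z : H, Function.invFunOn g T z = F z := fun z => by
    have := hginj.leftInvOn_invFunOn (F z).2
    rwa [hgF] at this
  refine ⟨Function.invFunOn g T, g, fun z hz => ?_, hgc, fun z hz => ?_, fun z hz => ?_,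
    fun z hz => ?_⟩
  · have := hasDerivAt_invFunOn hT hgd hginj (F ⟨z, hz⟩).2
    rw [hgF] at this
    exact this.differentiableAt.differentiableWithinAt
  · rw [hφ ⟨z, hz⟩]; exact (F _).2
  · rw [hφ ⟨z, hz⟩, hgF]
  · rw [hφ ⟨z, hz⟩, hFf]

theorem tendsto_re_of_exp_eq {α : Type*} {l : Filter α} {u v : α → ℂ}
    (h : ∀ᶠ x in l, Complex.exp (u x) = v x) (hv : Tendsto (fun x => ‖v x‖) l atTop) :
    Tendsto (fun x => (u x).re) l atTop := by
  refine (Real.tendsto_log_atTop.comp hv).congr' ?_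
  filter_upwards [h] with x hx
  rw [Function.comp_apply, ← hx, Complex.norm_exp, Real.log_exp]

/-- Along horizontal lines `φ` is unbounded because `f` is bounded on bounded parts of the tract.
Along vertical ones, a level set `‖f‖ = exp x` stays off the frontier, so its bounded parts are
compact in `T` and `g` is bounded there. -/
theorem IsLogarithmicTract.exists_repeller {f : ℂ → ℂ} (hf : MeromorphicNFOn f univ) {T : Set ℂ}
    (hT : IsLogarithmicTract f T) : ∃ X : Set ℂ, IsExpandingCantorRepeller f X ∧ 1 < dimH X := by
  obtain ⟨R₀, hR₀, hfront, hfT, hsc, h, hcov⟩ := hT.exists_radius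
  obtain ⟨φ, g, hφ⟩ := exists_isTractParametrization hT.isOpen hsc hR₀ hfT h hcov
  have hlarge : ∀ B : ℝ, ∃ C : ℝ, ∀ z ∈ T, ‖z‖ ≤ B → ‖f z‖ ≤ C := by
    intro B
    have hK : IsCompact (closure T ∩ closedBall 0 B) :=
      (isCompact_closedBall _ _).inter_left isClosed_closure
    obtain ⟨C, hC⟩ := hK.exists_bound_of_continuousOn (hT.continuousOn.mono inter_subset_left)
    exact ⟨C, fun z hz hzB => hC z ⟨subset_closure hz, mem_closedBall_zero_iff.2 hzB⟩⟩
  have hlevel : ∀ x B : ℝ, Real.log R₀ < x →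
      ∃ C : ℝ, ∀ z ∈ T, ‖z‖ ≤ B → ‖f z‖ = Real.exp x → ‖g z‖ ≤ C := by
    intro x B hx
    have hK : IsCompact ((closure T ∩ closedBall 0 B) ∩ f ⁻¹' sphere 0 (Real.exp x)) := by
      have h1 : IsCompact (closure T ∩ closedBall 0 B) :=
        (isCompact_closedBall _ _).inter_left isClosed_closure
      exact h1.of_isClosed_subset ((hT.continuousOn.mono inter_subset_left).preimage_isClosed_of_isClosed
        h1.isClosed isClosed_sphere) inter_subset_left
    have hsub : (closure T ∩ closedBall 0 B) ∩ f ⁻¹' sphere 0 (Real.exp x) ⊆ T := by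
      rintro z ⟨⟨hz, -⟩, hzx⟩
      by_contra hzT
      have h1 := hfront z ⟨hz, by rwa [hT.isOpen.interior_eq]⟩
      rw [mem_preimage, mem_sphere_zero_iff_norm, h1] at hzx
      rw [Real.log_lt_iff_lt_exp hR₀] at hx
      linarith
    obtain ⟨C, hC⟩ := hK.exists_bound_of_continuousOn (hφ.continuousOn_inverse.mono hsub)
    exact ⟨C, fun z hz hzB hzx => hC z ⟨⟨subset_closure hz, mem_closedBall_zero_iff.2 hzB⟩,
      mem_sphere_zero_iff_norm.2 hzx⟩⟩
  -- The last condition makes `φ` omit 0 on the smaller half-plane, even when `0 ∈ T`, so that `φ`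
  -- has a logarithm there.
  obtain ⟨R, hR1, hR2, hR3⟩ : ∃ R : ℝ, 0 < R ∧ Real.log R₀ < R ∧ ‖f 0‖ < Real.exp R :=
    ((eventually_gt_atTop 0).and ((eventually_gt_atTop _).and
      (Real.tendsto_exp_atTop.eventually_gt_atTop _))).exists
  have hsub : {z : ℂ | R < z.re} ⊆ {z : ℂ | Real.log R₀ < z.re} := fun z hz => hR2.trans hz
  have hφ0 : ∀ z ∈ {z : ℂ | R < z.re}, φ z ≠ 0 := by
    intro z hz h0
    have h1 := hφ.apply_eq_exp z (hsub hz)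
    have h2 : Real.exp R < Real.exp z.re := Real.exp_lt_exp.2 hz
    rw [h0] at h1
    rw [h1, Complex.norm_exp] at hR3
    linarith
  obtain ⟨L, hL, hLe⟩ := exists_log_of_convex (isOpen_lt_re R) (convex_halfSpace_re_gt R)
    ⟨((R + 1 : ℝ) : ℂ), by simp⟩ (hφ.differentiableOn.mono hsub) hφ0
  refine exists_repeller_of_logCoordinate hf hT.isOpen hfT hR1 hL ?_ ?_ ?_ ?_ ?_
  · intro x hx y hy hxy
    simp only [hLe x hx, hLe y hy] at hxy
    rw [← hφ.leftInverse x (hsub hx), hxy, hφ.leftInverse y (hsub hy)]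
  · intro z hz
    rw [hLe z hz]; exact hφ.mapsTo (hsub hz)
  · intro z hz
    rw [hLe z hz]; exact hφ.apply_eq_exp z (hsub hz)
  · have hmem : ∀ s : ℝ, R < s → (s : ℂ) ∈ {z : ℂ | R < z.re} := fun s hs => by simpa using hs
    refine tendsto_re_of_exp_eq ((eventually_gt_atTop R).mono fun s hs => hLe s (hmem s hs)) ?_
    refine tendsto_atTop.2 fun B => ?_
    obtain ⟨C, hC⟩ := hlarge B
    filter_upwards [eventually_gt_atTop R, Real.tendsto_exp_atTop.eventually_gt_atTop C]
      with s hs hsC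
    by_contra! hlt
    have h1 := hC _ (hφ.mapsTo (hsub (hmem s hs))) hlt.le
    rw [hφ.apply_eq_exp _ (hsub (hmem s hs)), Complex.norm_exp, Complex.ofReal_re] at h1
    linarith
  · intro x hx
    have hmem : ∀ y : ℝ, (x + y * Complex.I : ℂ) ∈ {z : ℂ | R < z.re} := fun y => by simpa using hx
    refine tendsto_re_of_exp_eq (.of_forall fun y => hLe _ (hmem y)) ?_
    refine tendsto_atTop.2 fun B => ?_
    obtain ⟨C, hC⟩ := hlevel x B (hR2.trans hx)
    filter_upwards [eventually_gt_atTop C] with y hy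
    by_contra! hlt
    have h1 := hC _ (hφ.mapsTo (hsub (hmem y))) hlt.le (by
      rw [hφ.apply_eq_exp _ (hsub (hmem y)), Complex.norm_exp]; simp)
    rw [hφ.leftInverse _ (hsub (hmem y))] at h1
    have h2 := (Complex.abs_im_le_norm _).trans h1
    simp only [Complex.add_im, Complex.ofReal_im, Complex.mul_im, Complex.I_im, Complex.I_re,
      Complex.ofReal_re, mul_one, mul_zero, add_zero, zero_add] at h2
    linarith [le_abs_self y]

/-! ### Rationality of meromorphic functions with tame behaviour at infinity -/

/-- An entire function of polynomial growth is a polynomial. -/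
theorem exists_polynomial_of_growth {g : ℂ → ℂ} (hg : Differentiable ℂ g) {C M : ℝ} {n : ℕ}
    (h : ∀ z, M < ‖z‖ → ‖g z‖ ≤ C * ‖z‖ ^ n) : ∃ p : Polynomial ℂ, ∀ z, g z = p.eval z := by
  have hzero : ∀ k, n < k → iteratedDeriv k g 0 = 0 := by
    intro k hk
    have hlim : Tendsto (fun R : ℝ => k.factorial * C / R) atTop (𝓝 0) :=
      tendsto_const_nhds.div_atTop tendsto_id
    have hle : ‖iteratedDeriv k g 0‖ ≤ 0 := by
      refine ge_of_tendsto hlim ?_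
      filter_upwards [eventually_gt_atTop (max M 1)] with R hR
      have hR1 : 1 < R := (le_max_right _ _).trans_lt hR
      have hRM : M < R := (le_max_left _ _).trans_lt hR
      have hbd : ∀ z ∈ sphere (0 : ℂ) R, ‖g z‖ ≤ C * R ^ n := fun z hz => by
        have hz' := mem_sphere_zero_iff_norm.1 hz
        rw [← hz']; exact h z (by rwa [hz'])
      have hC : 0 ≤ C := by
        obtain ⟨z, hz⟩ := (NormedSpace.sphere_nonempty (x := (0 : ℂ))).2 (by linarith : 0 ≤ R)
        have := (norm_nonneg _).trans (hbd z hz)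
        exact nonneg_of_mul_nonneg_left this (by positivity)
      have h1 := Complex.norm_iteratedDeriv_le_of_forall_mem_sphere_norm_le k (by linarith)
        hg.diffContOnCl hbd
      refine h1.trans ?_
      rw [div_le_div_iff₀ (by positivity) (by positivity)]
      have h2 : R ^ n * R ≤ R ^ k := by
        rw [← pow_succ]; exact pow_le_pow_right₀ hR1.le hk
      calc k.factorial * (C * R ^ n) * R = k.factorial * C * (R ^ n * R) := by ring
        _ ≤ _ := by gcongr
    exact norm_le_zero_iff.1 hle
  refine ⟨∑ k ∈ Finset.range (n + 1), Polynomial.C ((k.factorial : ℂ)⁻¹ * iteratedDeriv k g 0) *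
    Polynomial.X ^ k, fun z => ?_⟩
  rw [← Complex.taylorSeries_eq_of_entire' 0 z hg, tsum_eq_sum (s := Finset.range (n + 1))]
  · simp [Polynomial.eval_finsetSum]
  · intro k hk
    rw [hzero k (by simpa using hk)]; simp

theorem exists_norm_eval_le (p : Polynomial ℂ) : ∃ C : ℝ, ∀ z : ℂ, 1 ≤ ‖z‖ →
    ‖p.eval z‖ ≤ C * ‖z‖ ^ p.natDegree := by
  refine ⟨∑ k ∈ Finset.range (p.natDegree + 1), ‖p.coeff k‖, fun z hz => ?_⟩
  rw [Polynomial.eval_eq_sum_range, Finset.sum_mul]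
  refine (norm_sum_le _ _).trans (Finset.sum_le_sum fun k hk => ?_)
  rw [norm_mul, norm_pow]
  gcongr
  have := Finset.mem_range.1 hk; omega

theorem exists_eq_const_of_eval_ne_zero {p : Polynomial ℂ} (h : ∀ z, p.eval z ≠ 0) :
    ∃ c, p = Polynomial.C c := by
  have hdeg : p.degree ≤ 0 := by
    by_contra! hlt
    obtain ⟨z, hz⟩ := Complex.exists_root hlt
    exact h z hz
  exact ⟨_, Polynomial.eq_C_of_degree_le_zero hdeg⟩

/-- A meromorphic function which is analytic and bounded away from zero near infinity is
rational. -/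
theorem exists_rational_of_le_norm {f : ℂ → ℂ} (hf : MeromorphicOn f univ) {M r : ℝ} (hr : 0 < r)
    (hfM : ∀ z, M < ‖z‖ → AnalyticAt ℂ f z ∧ r ≤ ‖f z‖) :
    ∃ p q : Polynomial ℂ, q ≠ 0 ∧ ∀ z, AnalyticAt ℂ f z → q.eval z ≠ 0 →
      f z = p.eval z / q.eval z := by
  classical
  have horder : ∀ z, M < ‖z‖ → meromorphicOrderAt f z = 0 := fun z hz => by
    have h0 : f z ≠ 0 := fun h0 => by
      have := (hfM z hz).2
      rw [h0, norm_zero] at this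
      linarith
    rw [(hfM z hz).1.meromorphicOrderAt_eq, (hfM z hz).1.analyticOrderAt_eq_zero.2 h0]
    simp
  obtain ⟨z₁, hz₁⟩ : ∃ z₁ : ℂ, M < ‖z₁‖ := ⟨((|M| + 1 : ℝ) : ℂ), by
    rw [Complex.norm_real, Real.norm_eq_abs]
    exact (lt_of_le_of_lt (le_abs_self M) (lt_add_one _)).trans_le (le_abs_self _)⟩
  have htop : ∀ u : (univ : Set ℂ), meromorphicOrderAt f u ≠ ⊤ :=
    (hf.exists_meromorphicOrderAt_ne_top_iff_forall isConnected_univ).1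
      ⟨⟨z₁, mem_univ _⟩, by rw [horder z₁ hz₁]; simp⟩
  set D := MeromorphicOn.divisor f univ with hD
  have hDsub : D.support ⊆ closedBall 0 M := by
    intro z hz
    by_contra hzM
    rw [mem_closedBall_zero_iff, not_le] at hzM
    refine hz ?_
    rw [hD, MeromorphicOn.divisor_apply hf (mem_univ z), horder z hzM]
    simp
  have hfin : D.support.Finite := by
    refine ((MeromorphicOn.divisor f (closedBall 0 M)).finiteSupport
      (isCompact_closedBall 0 M)).subset fun z hz => ?_
    have hzM := hDsub hz
    rw [Function.mem_support, MeromorphicOn.divisor_apply (fun x _ => hf x (mem_univ x)) hzM]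
    rwa [Function.mem_support, hD, MeromorphicOn.divisor_apply hf (mem_univ z)] at hz
  obtain ⟨g, hg, hg0, hfg⟩ := hf.extract_zeros_poles htop hfin
  set S := hfin.toFinset with hS
  set p : Polynomial ℂ := ∏ u ∈ S, (Polynomial.X - Polynomial.C u) ^ (D u).toNat with hp
  set q : Polynomial ℂ := ∏ u ∈ S, (Polynomial.X - Polynomial.C u) ^ (-D u).toNat with hq
  have hq0 : q ≠ 0 := Finset.prod_ne_zero_iff.2 fun u _ =>
    pow_ne_zero _ (Polynomial.X_sub_C_ne_zero u)
  have hprod : ∀ z, z ∉ S → (∏ᶠ u, (· - u) ^ D u : ℂ → ℂ) z = p.eval z / q.eval z := by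
    intro z hz
    rw [finprod_eq_prod_of_mulSupport_subset (s := S)]
    · rw [Finset.prod_apply, hp, hq, Polynomial.eval_prod, Polynomial.eval_prod,
        ← Finset.prod_div_distrib]
      refine Finset.prod_congr rfl fun u hu => ?_
      have hzu : z - u ≠ 0 := by
        intro h; rw [sub_eq_zero.1 h] at hz; exact hz hu
      simp only [Pi.pow_apply, Polynomial.eval_pow, Polynomial.eval_sub, Polynomial.eval_X,
        Polynomial.eval_C]
      rw [← zpow_natCast, ← zpow_natCast, ← zpow_sub₀ hzu]
      congr 1
      omega
    · intro u hu
      rw [hS, hfin.coe_toFinset, Function.mem_support]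
      intro h0
      refine hu ?_
      simp only [h0, zpow_zero]
  have hroot : ∀ z, q.eval z ≠ 0 → ∀ᶠ w in 𝓝 z, q.eval w ≠ 0 := fun z hz =>
    q.continuous.continuousAt.eventually_ne hz
  have hcod : ∀ z, ∀ᶠ w in 𝓝[≠] z, f w = p.eval w / q.eval w * g w := by
    intro z
    have h1 : ∀ᶠ w in 𝓝[≠] z, f w = ((∏ᶠ u, (· - u) ^ D u : ℂ → ℂ) • g) w := by
      have := mem_codiscreteWithin_iff_forall_mem_nhdsNE.1 hfg z (mem_univ z)
      rw [compl_univ, union_empty] at this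
      exact this
    have h2 : ∀ᶠ w in 𝓝[≠] z, w ∉ S := by
      have := S.finite_toSet.subset (sdiff_subset (t := {z}))
      have h3 : ((S : Set ℂ) \ {z})ᶜ ∈ 𝓝 z := this.isClosed.isOpen_compl.mem_nhds (by simp)
      filter_upwards [nhdsWithin_le_nhds h3, self_mem_nhdsWithin] with w hw1 hw2 hw3
      exact hw1 ⟨hw3, hw2⟩
    filter_upwards [h1, h2] with w hw1 hw2
    rw [hw1, Pi.smul_apply', hprod w hw2, smul_eq_mul]
  have heq : ∀ z, AnalyticAt ℂ f z → q.eval z ≠ 0 → f z = p.eval z / q.eval z * g z := by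
    intro z hz hqz
    have h1 : ContinuousAt (fun w => p.eval w / q.eval w * g w) z :=
      (p.continuous.continuousAt.div q.continuous.continuousAt hqz).mul
        (hg z (mem_univ z)).continuousAt
    exact tendsto_nhds_unique_of_eventuallyEq (hz.continuousAt.tendsto.mono_left nhdsWithin_le_nhds)
      (h1.tendsto.mono_left nhdsWithin_le_nhds) (hcod z)
  have hg0' : ∀ z, g z ≠ 0 := fun z => hg0 ⟨z, mem_univ z⟩
  -- Near infinity `‖f‖ ≥ r` and `‖q‖ ≥ 1` give `1/g` polynomial growth; a polynomial without zeros
  -- is constant.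
  have hgd : Differentiable ℂ fun z => (g z)⁻¹ := fun z =>
    (hg z (mem_univ z)).differentiableAt.inv (hg0' z)
  obtain ⟨Cp, hCp⟩ := exists_norm_eval_le p
  have hqlarge : ∀ z : ℂ, M + 1 < ‖z‖ → 1 ≤ ‖q.eval z‖ := by
    intro z hz
    rw [hq, Polynomial.eval_prod, norm_prod]
    refine Finset.one_le_prod fun u hu => ?_
    rw [Polynomial.eval_pow, norm_pow]
    refine one_le_pow₀ ?_
    have h1 := mem_closedBall_zero_iff.1 (hDsub (hfin.mem_toFinset.1 hu))
    have h2 := norm_sub_norm_le z u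
    simp only [Polynomial.eval_sub, Polynomial.eval_X, Polynomial.eval_C]
    linarith
  obtain ⟨P, hP⟩ := exists_polynomial_of_growth hgd (M := max (M + 1) 1) (C := Cp / r)
    (n := p.natDegree) (by
      intro z hz
      have hz1 : M + 1 < ‖z‖ := (le_max_left _ _).trans_lt hz
      have hz2 : 1 < ‖z‖ := (le_max_right _ _).trans_lt hz
      have hqz := hqlarge z hz1
      have hqz0 : q.eval z ≠ 0 := fun h => by rw [h, norm_zero] at hqz; linarith
      obtain ⟨h1, h2⟩ := hfM z (by linarith)
      have h3 := heq z h1 hqz0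
      have h4 : ‖f z‖ * ‖q.eval z‖ = ‖p.eval z‖ * ‖g z‖ := by
        rw [← norm_mul, ← norm_mul, h3]
        field_simp
      have hgz : 0 < ‖g z‖ := norm_pos_iff.2 (hg0' z)
      have h5 : r ≤ Cp * ‖z‖ ^ p.natDegree * ‖g z‖ := by
        calc r ≤ ‖f z‖ * 1 := by rw [mul_one]; exact h2
          _ ≤ ‖f z‖ * ‖q.eval z‖ := by gcongr
          _ = ‖p.eval z‖ * ‖g z‖ := h4
          _ ≤ _ := by gcongr; exact hCp z hz2.le
      rw [norm_inv, inv_le_comm₀ hgz (by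
        have := pos_of_mul_pos_left (hr.trans_le h5) hgz.le
        rw [div_mul_eq_mul_div]; positivity)]
      have := pos_of_mul_pos_left (hr.trans_le h5) hgz.le
      rw [div_mul_eq_mul_div, inv_div, div_le_iff₀ this]
      linarith)
  obtain ⟨c, rfl⟩ := exists_eq_const_of_eval_ne_zero (p := P) fun z => by
    rw [← hP]; exact inv_ne_zero (hg0' z)
  have hgc : ∀ z, g z = c⁻¹ := fun z => by
    have := hP z
    rw [Polynomial.eval_C] at this
    rw [← this, inv_inv]
  refine ⟨p * Polynomial.C c⁻¹, q, hq0, fun z hz hqz => ?_⟩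
  rw [heq z hz hqz, hgc, Polynomial.eval_mul, Polynomial.eval_C]
  ring

/-- A rational expression off a finite set of poles makes the map non-transcendental. -/
theorem not_isTranscendental_of_rational {f : ℂ → ℂ}
    (hfin : (poles f).Finite) {p q : Polynomial ℂ} (hq : q ≠ 0)
    (h : ∀ z, z ∉ poles f → q.eval z ≠ 0 → f z = p.eval z / q.eval z) : ¬ IsTranscendental f := by
  intro hf'
  -- Multiplying numerator and denominator by `s` excludes the poles, where the value of `f` is only
  -- conventional.
  set s : Polynomial ℂ := ∏ u ∈ hfin.toFinset, (Polynomial.X - Polynomial.C u)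
  have hs : s ≠ 0 := Finset.prod_ne_zero_iff.2 fun u _ => Polynomial.X_sub_C_ne_zero u
  refine hf' ⟨p * s, q * s, mul_ne_zero hq hs, fun z hz => ?_⟩
  rw [Polynomial.eval_mul] at hz
  have hz2 := right_ne_zero_of_mul hz
  have hzp : z ∉ poles f := by
    intro hzp
    refine hz2 ?_
    rw [Polynomial.eval_prod]
    exact Finset.prod_eq_zero (hfin.mem_toFinset.2 hzp) (by simp)
  rw [h z hzp (left_ne_zero_of_mul hz), Polynomial.eval_mul, Polynomial.eval_mul,
    mul_div_mul_right _ _ hz2]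

theorem IsTranscendental.exists_norm_lt {f : ℂ → ℂ} (ht : IsTranscendental f)
    (hf : MeromorphicNFOn f univ) (hfin : (poles f).Finite) {r : ℝ} (hr : 0 < r) (M : ℝ) :
    ∃ z, M < ‖z‖ ∧ ‖f z‖ < r := by
  by_contra! hcon
  obtain ⟨N, hN⟩ := hfin.isBounded.exists_norm_le
  obtain ⟨p, q, hq, h⟩ := exists_rational_of_le_norm hf.meromorphicOn (M := max M N) hr
    fun z hz => ⟨analyticAt_of_notMem_poles hf fun hzp =>
      absurd (hN z hzp) (not_le.2 ((le_max_right _ _).trans_lt hz)),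
      hcon z ((le_max_left _ _).trans_lt hz)⟩
  exact not_isTranscendental_of_rational hfin hq
    (fun z hz => h z (analyticAt_of_notMem_poles hf hz)) ht

theorem IsTranscendental.exists_lt_norm {f : ℂ → ℂ} (ht : IsTranscendental f)
    (hf : MeromorphicNFOn f univ) (hfin : (poles f).Finite) (r M : ℝ) :
    ∃ z, M < ‖z‖ ∧ r < ‖f z‖ := by
  by_contra! hcon
  obtain ⟨N, hN⟩ := hfin.isBounded.exists_norm_le
  -- If `‖f‖ ≤ r` near infinity, then `f + c` is bounded below by 1 there and the rationality
  -- criterion applies.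
  set c : ℂ := ((|r| + 1 : ℝ) : ℂ) with hc
  have hcn : ‖c‖ = |r| + 1 := by
    rw [hc, Complex.norm_real, Real.norm_eq_abs, abs_of_pos (by positivity)]
  have hmer : MeromorphicOn (fun z => f z + c) univ :=
    hf.meromorphicOn.add fun z _ => MeromorphicAt.const c z
  obtain ⟨p, q, hq, h⟩ := exists_rational_of_le_norm hmer (M := max M N) one_pos
    fun z hz => by
      have hz1 := (le_max_left _ _).trans_lt hz
      have hz2 := (le_max_right _ _).trans_lt hz
      refine ⟨(analyticAt_of_notMem_poles hf fun hzp =>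
        absurd (hN z hzp) (not_le.2 hz2)).add analyticAt_const, ?_⟩
      have h1 := norm_sub_norm_le c (-f z)
      rw [sub_neg_eq_add, norm_neg, hcn, add_comm c] at h1
      linarith [hcon z hz1, le_abs_self r]
  refine not_isTranscendental_of_rational hfin (p := p - q * Polynomial.C c) hq
    (fun z hz hqz => ?_) ht
  have := h z ((analyticAt_of_notMem_poles hf hz).add analyticAt_const) hqz
  simp only [Polynomial.eval_sub, Polynomial.eval_mul, Polynomial.eval_C]
  rw [sub_div, mul_div_cancel_left₀ _ hqz]
  linear_combination this

/-! ### Logarithmic lifts of maps in the Eremenko–Lyubich class -/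

/-- Away from its poles, `f` is a covering over `{w | r < ‖w‖}`. -/
def IsCoveringAbove (f : ℂ → ℂ) (r : ℝ) : Prop :=
  IsCoveringMapOn (fun z : ((poles f)ᶜ : Set ℂ) => f z) {w | r < ‖w‖}

theorem IsClassB.exists_isCoveringAbove {f : ℂ → ℂ} (hB : IsClassB f) :
    ∃ ρ, ∀ r, ρ ≤ r → IsCoveringAbove f r := by
  obtain ⟨ρ, hρ⟩ := hB.exists_norm_le
  refine ⟨ρ, fun r hr w hw => ?_⟩
  by_contra h
  exact absurd (hρ w h) (not_le.2 (hr.trans_lt hw))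

theorem IsCoveringAbove.eqOn {f : ℂ → ℂ} {r : ℝ} (hf : IsCoveringAbove f r) {S : Set ℂ}
    (hS : IsPreconnected S) {u v : ℂ → ℂ} (hu : ContinuousOn u S) (hv : ContinuousOn v S)
    (hup : ∀ s ∈ S, u s ∉ poles f) (hvp : ∀ s ∈ S, v s ∉ poles f)
    (h : ∀ s ∈ S, f (u s) = f (v s)) (hr : ∀ s ∈ S, r < ‖f (u s)‖) {a : ℂ} (ha : a ∈ S)
    (hav : u a = v a) : EqOn u v S := by
  have hcov := hf.isCoveringMap_restrictPreimage
  have : PreconnectedSpace S := isPreconnected_iff_preconnectedSpace.1 hS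
  have hrv : ∀ s ∈ S, r < ‖f (v s)‖ := fun s hs => by rw [← h s hs]; exact hr s hs
  have h1 := hcov.eq_of_comp_eq
    (g₁ := fun s : S => ⟨⟨u s, hup s s.2⟩, hr s s.2⟩)
    (g₂ := fun s : S => ⟨⟨v s, hvp s s.2⟩, hrv s s.2⟩)
    (((continuousOn_iff_continuous_domRestrict.1 hu).subtype_mk fun s => hup s s.2).subtype_mk
      fun s => hr s s.2)
    (((continuousOn_iff_continuous_domRestrict.1 hv).subtype_mk fun s => hvp s s.2).subtype_mk
      fun s => hrv s s.2)
    (by ext s; exact h s s.2) ⟨a, ha⟩ (Subtype.ext (Subtype.ext hav))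
  intro s hs
  have h2 := congrFun h1 ⟨s, hs⟩
  exact congrArg (fun x => (x.1.1 : ℂ)) h2

theorem IsCoveringAbove.deriv_ne_zero {f : ℂ → ℂ} {r : ℝ} (hf : IsCoveringAbove f r)
    (hmf : MeromorphicNFOn f univ) (hfin : (poles f).Finite) {z : ℂ} (hz : z ∉ poles f)
    (hr : r < ‖f z‖) : deriv f z ≠ 0 := by
  have hopen : IsOpen ((poles f)ᶜ : Set ℂ) := hfin.isClosed.isOpen_compl
  obtain ⟨e, he, hfe⟩ := IsCoveringMapOn.isLocalHomeomorphOn hf ⟨z, hz⟩ hr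
  have hU : IsOpen (Subtype.val '' e.source : Set ℂ) := hopen.isOpenMap_subtype_val _ e.open_source
  refine deriv_ne_zero_of_injOn hU (f := f) ?_ ?_ ⟨_, he, rfl⟩
  · rintro _ ⟨w, -, rfl⟩
    exact (analyticAt_of_notMem_poles hmf w.2).differentiableAt.differentiableWithinAt
  · rintro _ ⟨w, hw, rfl⟩ _ ⟨w', hw', rfl⟩ hww
    refine congrArg Subtype.val (e.injOn hw hw' ?_)
    rw [← hfe]; exact hww

theorem IsCoveringAbove.exists_lift {f : ℂ → ℂ} {c : ℝ} (hf : IsCoveringAbove f (Real.exp c))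
    {z₀ ζ₀ : ℂ} (hz₀ : z₀ ∉ poles f) (hζ₀ : c < ζ₀.re) (h₀ : Complex.exp ζ₀ = f z₀) :
    ∃ φ : ℂ → ℂ, ContinuousOn φ {ζ | c < ζ.re} ∧ φ ζ₀ = z₀ ∧
      ∀ ζ : ℂ, c < ζ.re → φ ζ ∉ poles f ∧ f (φ ζ) = Complex.exp ζ := by
  classical
  have := simplyConnectedSpace_lt_re c
  have : LocallyPathConnectedSpace {ζ : ℂ | c < ζ.re} :=
    (isOpen_lt_re _).locallyPathConnectedSpace
  obtain ⟨F, ⟨hF0, hF⟩, -⟩ := IsCoveringMapOn.existsUnique_continuousMap_lifts hf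
    (A := {ζ : ℂ | c < ζ.re}) ⟨fun ζ => Complex.exp ζ, by fun_prop⟩ (a₀ := ⟨ζ₀, hζ₀⟩)
    (e₀ := ⟨z₀, hz₀⟩) h₀.symm fun ζ => by
      change _ < ‖Complex.exp ζ‖
      rw [Complex.norm_exp]; exact Real.exp_lt_exp.2 ζ.2
  have hφ : ∀ ζ : {ζ : ℂ | c < ζ.re},
      (fun ζ : ℂ => if h : c < ζ.re then (F ⟨ζ, h⟩ : ℂ) else 0) ζ = F ζ := fun ζ => dif_pos ζ.2
  refine ⟨fun ζ => if h : c < ζ.re then F ⟨ζ, h⟩ else 0, ?_, ?_, fun ζ hζ => ?_⟩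
  · rw [continuousOn_iff_continuous_domRestrict]
    exact (continuous_subtype_val.comp F.continuous).congr fun ζ => (hφ ζ).symm
  · exact (hφ ⟨ζ₀, hζ₀⟩).trans (congrArg Subtype.val hF0)
  · have h1 := hφ ⟨ζ, hζ⟩
    simp only at h1 ⊢
    rw [h1]
    exact ⟨(F _).2, congrFun hF ⟨ζ, hζ⟩⟩

/-- `φ` is a lift of the exponential function on the half-plane `{c < Re ζ}` through `f` with
values in a neighbourhood `{M < ‖z‖}` of infinity, on which `f` has no poles. -/
structure IsLogLift (f φ : ℂ → ℂ) (c M : ℝ) : Prop where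
  meromorphic : MeromorphicNFOn f univ
  finite_poles : (poles f).Finite
  covering : IsCoveringAbove f (Real.exp c)
  norm_lt : ∀ z ∈ poles f, ‖z‖ < M
  continuousOn : ContinuousOn φ {ζ | c < ζ.re}
  lt_norm : ∀ ζ : ℂ, c < ζ.re → M < ‖φ ζ‖
  apply_eq_exp : ∀ ζ : ℂ, c < ζ.re → f (φ ζ) = Complex.exp ζ

/-- On a circle around all poles `‖f‖ < exp c`, while `‖f ∘ φ‖ > exp c`; a lift starting outside the
circle can never cross it. -/
theorem exists_isLogLift {f : ℂ → ℂ} (hf : MeromorphicNFOn f univ) (ht : IsTranscendental f)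
    (hfin : (poles f).Finite) (hB : IsClassB f) : ∃ φ c M, 0 < M ∧ IsLogLift f φ c M := by
  obtain ⟨ρ, hρ⟩ := hB.exists_isCoveringAbove
  obtain ⟨N, hN0, hN⟩ := hfin.isBounded.exists_pos_norm_lt
  have hcont : ContinuousOn f (sphere 0 N) := fun z hz =>
    (analyticAt_of_notMem_poles hf fun hzp => by
      have := hN z hzp
      rw [mem_sphere_zero_iff_norm] at hz
      linarith).continuousAt.continuousWithinAt
  obtain ⟨K, hK⟩ := (isCompact_sphere (0 : ℂ) N).exists_bound_of_continuousOn hcont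
  set c := max ρ K
  have hc : c < Real.exp c := by linarith [Real.add_one_le_exp c]
  have hcov := hρ (Real.exp c) ((le_max_left ρ K).trans hc.le)
  obtain ⟨z₀, hz₀, hfz₀⟩ := ht.exists_lt_norm hf hfin (Real.exp c) N
  have hf0 : f z₀ ≠ 0 := norm_pos_iff.1 ((Real.exp_pos c).trans hfz₀)
  have hζ₀ : c < (Complex.log (f z₀)).re := by
    rw [Complex.log_re]; exact (Real.lt_log_iff_exp_lt (norm_pos_iff.2 hf0)).2 hfz₀
  obtain ⟨φ, hφc, hφ0, hφ⟩ := hcov.exists_lift (fun h => absurd (hN z₀ h) hz₀.not_gt) hζ₀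
    (Complex.exp_log hf0)
  have hsph : ∀ z : ℂ, ‖z‖ = N → ‖f z‖ < Real.exp c := fun z hz =>
    (hK z (mem_sphere_zero_iff_norm.2 hz)).trans_lt ((le_max_right ρ K).trans_lt hc)
  refine ⟨φ, c, N, hN0, hf, hfin, hcov, hN, hφc, fun ζ hζ => ?_, fun ζ hζ => (hφ ζ hζ).2⟩
  by_contra! hle
  obtain ⟨ξ, hξ, hξN⟩ := (convex_halfSpace_re_gt c).isPreconnected.intermediate_value hζ hζ₀
    hφc.norm ⟨hle, by rw [hφ0]; exact hz₀.le⟩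
  have h1 := hsph _ hξN
  rw [(hφ ξ hξ).2, Complex.norm_exp, Real.exp_lt_exp] at h1
  exact absurd hξ h1.not_gt

namespace IsLogLift

variable {f φ : ℂ → ℂ} {c M : ℝ}

theorem notMem_poles (h : IsLogLift f φ c M) {z : ℂ} (hz : M ≤ ‖z‖) : z ∉ poles f :=
  fun hp => absurd (h.norm_lt z hp) hz.not_gt

theorem analyticAt (h : IsLogLift f φ c M) {z : ℂ} (hz : M ≤ ‖z‖) : AnalyticAt ℂ f z :=
  analyticAt_of_notMem_poles h.meromorphic (h.notMem_poles hz)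

theorem lt_norm_apply (h : IsLogLift f φ c M) {ζ : ℂ} (hζ : c < ζ.re) :
    Real.exp c < ‖f (φ ζ)‖ := by
  rw [h.apply_eq_exp ζ hζ, Complex.norm_exp]; exact Real.exp_lt_exp.2 hζ

theorem differentiableOn (h : IsLogLift f φ c M) : DifferentiableOn ℂ φ {ζ | c < ζ.re} :=
  differentiableOn_of_comp_eq (isOpen_lt_re c) h.continuousOn
    Complex.differentiable_exp.differentiableOn
    (fun ζ hζ => h.analyticAt (h.lt_norm ζ hζ).le)
    (fun ζ hζ => h.covering.deriv_ne_zero h.meromorphic h.finite_poles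
      (h.notMem_poles (h.lt_norm ζ hζ).le) (h.lt_norm_apply hζ)) h.apply_eq_exp

theorem differentiableAt (h : IsLogLift f φ c M) {ζ : ℂ} (hζ : c < ζ.re) :
    DifferentiableAt ℂ φ ζ :=
  h.differentiableOn.differentiableAt ((isOpen_lt_re c).mem_nhds hζ)

theorem deriv_ne_zero (h : IsLogLift f φ c M) {ζ : ℂ} (hζ : c < ζ.re) : deriv φ ζ ≠ 0 := by
  intro h0
  have h1 : HasDerivAt (f ∘ φ) (deriv f (φ ζ) * deriv φ ζ) ζ :=
    (h.analyticAt (h.lt_norm ζ hζ).le).differentiableAt.hasDerivAt.comp ζ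
      (h.differentiableAt hζ).hasDerivAt
  have h2 : f ∘ φ =ᶠ[𝓝 ζ] Complex.exp := by
    filter_upwards [(isOpen_lt_re c).mem_nhds hζ] with ξ hξ using h.apply_eq_exp ξ hξ
  have h3 := (h1.congr_of_eventuallyEq h2.symm).unique (Complex.hasDerivAt_exp ζ)
  rw [h0, mul_zero] at h3
  exact Complex.exp_ne_zero ζ h3.symm

theorem isOpen_image (h : IsLogLift f φ c M) {U : Set ℂ} (hU : IsOpen U)
    (hUc : U ⊆ {ζ | c < ζ.re}) : IsOpen (φ '' U) := by
  rw [isOpen_iff_mem_nhds]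
  rintro _ ⟨ζ, hζ, rfl⟩
  have hs : HasStrictDerivAt φ (deriv φ ζ) ζ :=
    (h.differentiableOn.analyticAt ((isOpen_lt_re c).mem_nhds (hUc hζ))).hasStrictDerivAt
  rw [← hs.map_nhds_eq (h.deriv_ne_zero (hUc hζ))]
  exact image_mem_map (hU.mem_nhds hζ)

theorem exists_forall_lt_norm (h : IsLogLift f φ c M) (B : ℝ) :
    ∃ X, ∀ ζ : ℂ, c < ζ.re → X < ζ.re → B < ‖φ ζ‖ := by
  have hcpt : IsCompact (closedBall (0 : ℂ) B ∩ {z | M ≤ ‖z‖}) :=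
    (isCompact_closedBall _ _).inter_right (isClosed_le continuous_const continuous_norm)
  obtain ⟨K, hK⟩ := hcpt.exists_bound_of_continuousOn (f := f) fun z hz =>
    (h.analyticAt hz.2).continuousAt.continuousWithinAt
  refine ⟨K, fun ζ hζ hX => ?_⟩
  by_contra! hle
  have h1 := hK (φ ζ) ⟨mem_closedBall_zero_iff.2 hle, (h.lt_norm ζ hζ).le⟩
  rw [h.apply_eq_exp ζ hζ, Complex.norm_exp] at h1
  linarith [Real.add_one_le_exp ζ.re]

/-- Two points with one image differ by `2πin`; then `φ` and its translate by `2πin` are lifts of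
`exp` that agree at a point, hence everywhere. -/
theorem exists_periodic_of_not_injOn (h : IsLogLift f φ c M)
    (hinj : ¬ InjOn φ {ζ | c < ζ.re}) :
    ∃ τ > 0, ∀ ζ : ℂ, c < ζ.re → φ (ζ + (τ : ℝ) * Complex.I) = φ ζ := by
  rw [InjOn] at hinj
  push Not at hinj
  obtain ⟨a, ha, b, hb, hab, hne⟩ := hinj
  have key : ∀ a b : ℂ, c < a.re → c < b.re → φ a = φ b → ∀ n : ℤ,
      a = b + n * (2 * Real.pi * Complex.I) →
      ∀ ζ : ℂ, c < ζ.re → φ (ζ + n * (2 * Real.pi * Complex.I)) = φ ζ := by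
    intro a b ha hb hab n hn
    have hre : ∀ ζ : ℂ, (ζ + n * (2 * Real.pi * Complex.I)).re = ζ.re := fun ζ => by simp
    have hmem : ∀ ζ : ℂ, c < ζ.re → c < (ζ + n * (2 * Real.pi * Complex.I)).re :=
      fun ζ hζ => by rwa [hre]
    refine h.covering.eqOn (convex_halfSpace_re_gt c).isPreconnected (a := b)
      (u := fun ζ => φ (ζ + n * (2 * Real.pi * Complex.I)))
      (h.continuousOn.comp (by fun_prop) hmem) h.continuousOn
      (fun ζ hζ => h.notMem_poles (h.lt_norm _ (hmem ζ hζ)).le)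
      (fun ζ hζ => h.notMem_poles (h.lt_norm _ hζ).le) (fun ζ hζ => ?_)
      (fun ζ hζ => h.lt_norm_apply (hmem ζ hζ)) hb (by rw [← hn, hab])
    rw [h.apply_eq_exp _ (hmem ζ hζ), h.apply_eq_exp _ hζ, Complex.exp_add,
      Complex.exp_int_mul_two_pi_mul_I, mul_one]
  obtain ⟨n, hn⟩ := Complex.exp_eq_exp_iff_exists_int.1
    ((h.apply_eq_exp a ha).symm.trans ((congrArg f hab).trans (h.apply_eq_exp b hb)))
  have hn0 : n ≠ 0 := by
    rintro rfl
    exact hne (by simpa using hn)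
  rcases hn0.lt_or_gt with hlt | hgt
  · refine ⟨2 * Real.pi * (-n : ℤ), by
      have : (0 : ℝ) < ((-n : ℤ) : ℝ) := by exact_mod_cast (by omega : (0 : ℤ) < -n)
      positivity, fun ζ hζ => ?_⟩
    rw [← key b a hb ha hab.symm (-n) (by rw [hn]; push_cast; ring) ζ hζ]
    congr 1; push_cast; ring
  · refine ⟨2 * Real.pi * n, by
      have : (0 : ℝ) < (n : ℝ) := by exact_mod_cast hgt
      positivity, fun ζ hζ => ?_⟩
    rw [← key a b ha hb hab n hn ζ hζ]
    congr 1; push_cast; ring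

theorem isPreconnected_lt_norm {r : ℝ} (hr : 0 < r) : IsPreconnected {z : ℂ | r < ‖z‖} := by
  have : {z : ℂ | r < ‖z‖} = Complex.exp '' {ζ | Real.log r < ζ.re} := by
    ext z
    constructor
    · intro hz
      have h0 : z ≠ 0 := norm_pos_iff.1 (hr.trans hz)
      exact ⟨Complex.log z, by
        rw [mem_ofPred_eq, Complex.log_re]; exact Real.log_lt_log hr hz, Complex.exp_log h0⟩
    · rintro ⟨ζ, hζ, rfl⟩
      rw [mem_ofPred_eq, Complex.norm_exp, ← Real.log_lt_iff_lt_exp hr]; exact hζ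
  rw [this]
  exact (convex_halfSpace_re_gt _).isPreconnected.image _ Complex.continuous_exp.continuousOn

/-- For periodic `φ` the line `Re ζ = c + 1` has image bounded by some `M'`, and the half-plane to
its right has image open and relatively closed in the connected set `{M' < ‖z‖}`. So `‖f‖ > exp c`
near infinity, contradicting transcendence. -/
theorem injOn (h : IsLogLift f φ c M) (ht : IsTranscendental f) (hM : 0 < M) :
    InjOn φ {ζ | c < ζ.re} := by
  by_contra hinj
  obtain ⟨τ, hτ, hper⟩ := h.exists_periodic_of_not_injOn hinj
  have hperz : ∀ ζ : ℂ, c < ζ.re → ∃ ξ : ℂ, ξ.re = ζ.re ∧ ξ.im ∈ Icc 0 τ ∧ φ ξ = φ ζ := by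
    intro ζ hζ
    have hP : Function.Periodic (fun y : ℝ => φ (ζ.re + y * Complex.I)) τ := fun y => by
      have := hper (ζ.re + y * Complex.I) (by simpa using hζ)
      simp only
      rw [← this]; congr 1; push_cast; ring
    obtain ⟨y, hy, hyf⟩ := hP.exists_mem_Ico₀ hτ ζ.im
    refine ⟨ζ.re + y * Complex.I, by simp, by simpa using Ico_subset_Icc_self hy, ?_⟩
    simp only [Complex.re_add_im] at hyf
    exact hyf.symm
  have hcpt : ∀ X, IsCompact (Icc (c + 1) X ×ℂ Icc 0 τ) := fun X =>
    isCompact_Icc.reProdIm isCompact_Icc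
  have hsub : ∀ X, Icc (c + 1) X ×ℂ Icc 0 τ ⊆ {ζ | c < ζ.re} := fun X ζ hζ => by
    have := hζ.1.1
    exact lt_of_lt_of_le (by linarith) this
  obtain ⟨M', hM'⟩ := (hcpt (c + 1)).exists_bound_of_continuousOn (h.continuousOn.mono (hsub _))
  have hline : ∀ ζ : ℂ, ζ.re = c + 1 → ‖φ ζ‖ ≤ M' := fun ζ hζ => by
    obtain ⟨ξ, h1, h2, h3⟩ := hperz ζ (by linarith)
    rw [← h3]
    exact hM' ξ ⟨⟨by rw [h1, hζ], by rw [h1, hζ]⟩, h2⟩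
  have hM'0 : 0 < M' := by
    refine hM.trans (lt_of_lt_of_le (h.lt_norm ((c + 1 : ℝ) : ℂ) (by simp)) (hline _ (by simp)))
  have hcover : {z : ℂ | M' < ‖z‖} ⊆ φ '' {ζ | c + 1 < ζ.re} := by
    refine (isPreconnected_lt_norm hM'0).subset_of_closure_inter_subset
      (h.isOpen_image (isOpen_lt_re _) fun ζ (hζ : c + 1 < ζ.re) =>
        (by linarith : c < c + 1).trans hζ) ?_ ?_
    · obtain ⟨X, hX⟩ := h.exists_forall_lt_norm M'
      set x : ℝ := max (c + 1) X + 1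
      have hx1 : c + 1 < x := (le_max_left _ X).trans_lt (lt_add_one _)
      have hx2 : X < x := (le_max_right (c + 1) X).trans_lt (lt_add_one _)
      exact ⟨φ x, hX x (by rw [Complex.ofReal_re]; linarith) (by simpa using hx2),
        x, by simpa using hx1, rfl⟩
    · rintro z ⟨hz, hzM⟩
      obtain ⟨X, hX⟩ := h.exists_forall_lt_norm (‖z‖ + 1)
      have h1 : z ∈ closure (φ '' {ζ | c + 1 < ζ.re} ∩ ball 0 (‖z‖ + 1)) := by
        rw [inter_comm]
        exact isOpen_ball.inter_closure ⟨by simp, hz⟩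
      -- Periodicity bounds the imaginary part and growth of `φ` the real part, so bounded pieces of
      -- the image come from a compact rectangle.
      have h2 : φ '' {ζ | c + 1 < ζ.re} ∩ ball 0 (‖z‖ + 1) ⊆
          φ '' (Icc (c + 1) X ×ℂ Icc 0 τ) := by
        rintro _ ⟨⟨ζ, hζ, rfl⟩, hb⟩
        have hζ' : c + 1 < ζ.re := hζ
        have hζc : c < ζ.re := by linarith
        obtain ⟨ξ, h1, h2, h3⟩ := hperz ζ hζc
        refine ⟨ξ, ⟨⟨by rw [h1]; exact hζ'.le, ?_⟩, h2⟩, h3⟩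
        by_contra! hlt
        have := hX ζ hζc (by rwa [← h1])
        rw [mem_ball_zero_iff] at hb
        linarith
      obtain ⟨ζ, hζ, rfl⟩ := closure_minimal h2
        ((hcpt X).image_of_continuousOn (h.continuousOn.mono (hsub X))).isClosed h1
      refine ⟨ζ, lt_of_le_of_ne hζ.1.1 fun heq => ?_, rfl⟩
      exact absurd (hline ζ heq.symm) (not_le.2 hzM)
  obtain ⟨z, hz, hfz⟩ := ht.exists_norm_lt h.meromorphic h.finite_poles (Real.exp_pos c) M'
  obtain ⟨ζ, hζ, rfl⟩ := hcover hz
  have hζ' : c + 1 < ζ.re := hζ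
  exact absurd (h.lt_norm_apply (by linarith)) hfz.not_gt

/-- Points in the closure of the image of a smaller half-plane are still in the image. -/
theorem closure_image_subset (h : IsLogLift f φ c M) {x : ℝ} (hx : c < x) :
    closure (φ '' {ζ | x < ζ.re}) ⊆ φ '' {ζ | x ≤ ζ.re} := by
  intro z hz
  have hM : M ≤ ‖z‖ := closure_minimal (t := {z : ℂ | M ≤ ‖z‖})
    (by rintro _ ⟨ζ, hζ, rfl⟩; exact (h.lt_norm ζ (hx.trans hζ)).le)
    (isClosed_le continuous_const continuous_norm) hz
  have hfz : Real.exp x ≤ ‖f z‖ := by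
    have := mem_closure_iff_nhdsWithin_neBot.1 hz
    refine ge_of_tendsto ((h.analyticAt hM).continuousAt.norm.tendsto.mono_left
      (nhdsWithin_le_nhds (s := φ '' {ζ | x < ζ.re}))) ?_
    filter_upwards [self_mem_nhdsWithin] with w hw
    obtain ⟨ζ, hζ, rfl⟩ := hw
    rw [h.apply_eq_exp ζ (hx.trans hζ), Complex.norm_exp]
    exact Real.exp_le_exp.2 (le_of_lt hζ)
  have hev : ∀ᶠ w in 𝓝 z, w ∉ poles f ∧ Real.exp c < ‖f w‖ := by
    refine (h.finite_poles.isClosed.isOpen_compl.eventually_mem (h.notMem_poles hM)).and ?_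
    exact (h.analyticAt hM).continuousAt.norm.eventually_const_lt
      ((Real.exp_lt_exp.2 hx).trans_le hfz)
  obtain ⟨ε, hε, hball⟩ := Metric.eventually_nhds_iff_ball.1 hev
  obtain ⟨l, hl, hle⟩ := exists_log_of_convex isOpen_ball (convex_ball z ε) ⟨z, mem_ball_self hε⟩
    (fun w hw => (analyticAt_of_notMem_poles h.meromorphic
      (hball w hw).1).differentiableAt.differentiableWithinAt)
    (fun w hw => norm_pos_iff.1 ((Real.exp_pos c).trans (hball w hw).2))
  obtain ⟨_, hwb, ζ, hζ, rfl⟩ := mem_closure_iff.1 hz _ isOpen_ball (mem_ball_self hε)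
  obtain ⟨n, hn⟩ := Complex.exp_eq_exp_iff_exists_int.1
    ((h.apply_eq_exp ζ (hx.trans hζ)).symm.trans (hle _ hwb).symm)
  -- This branch of `log f` satisfies `φ (l' w) = w` at one point near `z`, hence on the whole ball
  -- by uniqueness of lifts, in particular at `z`.
  set l' : ℂ → ℂ := fun w => l w + n * (2 * Real.pi * Complex.I) with hl'
  have hle' : ∀ w ∈ ball z ε, Complex.exp (l' w) = f w := fun w hw => by
    rw [hl', Complex.exp_add, Complex.exp_int_mul_two_pi_mul_I, mul_one, hle w hw]
  have hre : ∀ w ∈ ball z ε, Real.exp (l' w).re = ‖f w‖ := fun w hw => by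
    rw [← hle' w hw, Complex.norm_exp]
  have hmem : ∀ w ∈ ball z ε, c < (l' w).re := fun w hw => by
    rw [← Real.exp_lt_exp, hre w hw]; exact (hball w hw).2
  have heq := h.covering.eqOn (convex_ball z ε).isPreconnected (u := fun w => φ (l' w))
    (v := fun w => w) (h.continuousOn.comp (hl.continuousOn.add continuousOn_const) hmem)
    continuousOn_id (fun w hw => h.notMem_poles (h.lt_norm _ (hmem w hw)).le)
    (fun w hw => (hball w hw).1) (fun w hw => by rw [h.apply_eq_exp _ (hmem w hw), hle' w hw])
    (fun w hw => h.lt_norm_apply (hmem w hw)) hwb (by simp only [hl', ← hn])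
  refine ⟨l' z, ?_, heq (mem_ball_self hε)⟩
  rw [mem_ofPred_eq, ← Real.exp_le_exp, hre z (mem_ball_self hε)]
  exact hfz

theorem closure_image (h : IsLogLift f φ c M) {x : ℝ} (hx : c < x) :
    closure (φ '' {ζ | x < ζ.re}) = φ '' {ζ | x ≤ ζ.re} := by
  refine (h.closure_image_subset hx).antisymm ?_
  rintro _ ⟨ζ, hζ, rfl⟩
  have h1 : ζ ∈ closure {ζ : ℂ | x < ζ.re} := by
    rw [Complex.closure_setOfPred_lt_re]; exact hζ
  exact (h.differentiableAt (hx.trans_le hζ)).continuousAt.continuousWithinAt.mem_closure_image h1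

theorem frontier_image (h : IsLogLift f φ c M) (hinj : InjOn φ {ζ | c < ζ.re}) {x : ℝ}
    (hx : c < x) : frontier (φ '' {ζ | x < ζ.re}) = φ '' {ζ | ζ.re = x} := by
  have hsub : {ζ : ℂ | x ≤ ζ.re} ⊆ {ζ | c < ζ.re} := fun ζ hζ => hx.trans_le hζ
  have hsub' : {ζ : ℂ | x < ζ.re} ⊆ {ζ | x ≤ ζ.re} := fun ζ (hζ : x < ζ.re) => hζ.le
  rw [(h.isOpen_image (isOpen_lt_re x) fun ζ hζ => hx.trans hζ).frontier_eq, h.closure_image hx,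
    ← (hinj.mono hsub).image_sdiff_subset hsub']
  congr 1
  ext ζ
  exact ⟨fun h => le_antisymm (not_lt.1 h.2) h.1, fun h => ⟨Eq.ge h, (Eq.le h).not_gt⟩⟩

/-- The arcs are the images of the unit segments of the line `Re ζ = x`. As `x > c`, `φ` is
injective and open around this line, which gives regularity and local finiteness. -/
theorem hasPiecewiseSmoothBoundary (h : IsLogLift f φ c M) (hinj : InjOn φ {ζ | c < ζ.re}) {x : ℝ}
    (hx : c < x) : HasPiecewiseSmoothBoundary (φ '' {ζ | x < ζ.re}) := by
  have hre : ∀ (n : ℤ) (t : ℝ), (x + (n + t) * Complex.I : ℂ).re = x := fun n t => by simp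
  have him : ∀ (n : ℤ) (t : ℝ), (x + (n + t) * Complex.I : ℂ).im = n + t := fun n t => by simp
  have hmem : ∀ (n : ℤ) (t : ℝ), c < (x + (n + t) * Complex.I : ℂ).re := fun n t => by rwa [hre]
  have hγ : ∀ (n : ℤ) (t : ℝ), HasDerivAt (fun t : ℝ => φ (x + (n + t) * Complex.I))
      (deriv φ (x + (n + t) * Complex.I) * Complex.I) t := fun n t => by
    have h1 : HasDerivAt (fun t : ℝ => (x + (n + t) * Complex.I : ℂ)) Complex.I t := by
      have := (((hasDerivAt_id t).ofReal_comp.const_add (n : ℂ)).mul_const Complex.I).const_add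
        (x : ℂ)
      simpa using this
    exact (h.differentiableAt (hmem n t)).hasDerivAt.comp t h1
  have heq : ∀ (n m : ℤ) (s t : ℝ), φ (x + (n + s) * Complex.I) = φ (x + (m + t) * Complex.I) →
      (n : ℝ) + s = m + t := fun n m s t hst => by
    have := congrArg Complex.im (hinj (hmem n s) (hmem m t) hst)
    rwa [him, him] at this
  have hfront := h.frontier_image hinj hx
  have hunion : (⋃ n : ℤ, (fun t : ℝ => φ (x + (n + t) * Complex.I)) '' Icc (0 : ℝ) 1) =
      frontier (φ '' {ζ | x < ζ.re}) := by
    rw [hfront]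
    ext z
    simp only [mem_iUnion]
    constructor
    · rintro ⟨n, t, -, rfl⟩
      exact ⟨_, hre n t, rfl⟩
    · rintro ⟨ζ, hζ, rfl⟩
      refine ⟨⌊ζ.im⌋, Int.fract ζ.im, ⟨Int.fract_nonneg _, (Int.fract_lt_one _).le⟩, ?_⟩
      have hζ' : ζ.re = x := hζ
      refine congrArg φ ?_
      apply Complex.ext
      · rw [hre, hζ']
      · rw [him, Int.floor_add_fract]
  refine ⟨ℤ, fun n t => φ (x + (n + t) * Complex.I), fun n => ⟨?_, ?_, ?_⟩, ?_, ?_, hunion⟩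
  · refine ContDiff.contDiffOn (contDiff_iff_contDiffAt.2 fun t => ?_)
    have h1 : ContDiffAt ℝ 1 φ (x + (n + t) * Complex.I) :=
      ((h.differentiableOn.contDiffOn (isOpen_lt_re c)).contDiffAt
        ((isOpen_lt_re c).mem_nhds (hmem n t))).restrict_scalars ℝ
    have h2 : ContDiffAt ℝ 1 (fun t : ℝ => (x + (n + t) * Complex.I : ℂ)) t := by
      have : ContDiff ℝ 1 fun t : ℝ => (t : ℂ) := Complex.ofRealCLM.contDiff
      fun_prop
    exact ContDiffAt.comp t h1 h2
  · intro s _ t _ hst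
    have := heq n n s t hst
    linarith
  · intro t ht
    rw [(hγ n t).hasDerivWithinAt.derivWithin (uniqueDiffOn_Icc zero_lt_one t ht)]
    exact mul_ne_zero (h.deriv_ne_zero (hmem n t)) Complex.I_ne_zero
  · rintro n m hnm _ ⟨⟨s, hs, rfl⟩, ⟨t, ht, hts⟩⟩
    have h1 := heq m n t s hts
    have hcases : (n = m + 1 ∧ s = 0 ∧ t = 1) ∨ (m = n + 1 ∧ s = 1 ∧ t = 0) := by
      rcases lt_or_gt_of_ne hnm with hlt | hgt
      · have h2 : (n : ℝ) + 1 ≤ m := by exact_mod_cast hlt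
        have h3 : (m : ℝ) = n + 1 := le_antisymm (by linarith [hs.2, ht.1]) h2
        exact Or.inr ⟨by exact_mod_cast h3, by linarith [hs.2, ht.1], by linarith [hs.2, ht.1]⟩
      · have h2 : (m : ℝ) + 1 ≤ n := by exact_mod_cast hgt
        have h3 : (n : ℝ) = m + 1 := le_antisymm (by linarith [hs.1, ht.2]) h2
        exact Or.inl ⟨by exact_mod_cast h3, by linarith [hs.1, ht.2], by linarith [hs.1, ht.2]⟩
    rcases hcases with ⟨-, rfl, rfl⟩ | ⟨-, rfl, rfl⟩
    · exact ⟨Or.inl rfl, Or.inr hts.symm⟩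
    · exact ⟨Or.inr rfl, Or.inl hts.symm⟩
  · intro z
    by_cases hz : z ∈ frontier (φ '' {ζ | x < ζ.re})
    · have hz' := hz
      rw [hfront] at hz'
      obtain ⟨ζ, hζ, rfl⟩ := hz'
      have hζc : c < ζ.re := by rw [show ζ.re = x from hζ]; exact hx
      refine ⟨φ '' (ball ζ 1 ∩ {ζ | c < ζ.re}),
        (h.isOpen_image (isOpen_ball.inter (isOpen_lt_re c)) inter_subset_right).mem_nhds
          ⟨ζ, ⟨mem_ball_self one_pos, hζc⟩, rfl⟩, ?_⟩
      refine (finite_Icc (⌊ζ.im⌋ - 2) (⌊ζ.im⌋ + 2)).subset ?_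
      rintro n ⟨_, ⟨t, ht, rfl⟩, ⟨ξ, ⟨hξ, hξc⟩, hξt⟩⟩
      have h1 := congrArg Complex.im (hinj hξc (hmem n t) hξt)
      rw [him] at h1
      have h2 : |ξ.im - ζ.im| < 1 := by
        rw [mem_ball, dist_eq_norm] at hξ
        exact (Complex.abs_im_le_norm (ξ - ζ)).trans_lt hξ
      rw [h1, abs_lt] at h2
      have h3 := Int.floor_le ζ.im
      have h4 := Int.lt_floor_add_one ζ.im
      have h5 : ((⌊ζ.im⌋ : ℤ) : ℝ) - 2 < n := by linarith [ht.2]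
      have h6 : (n : ℝ) < (⌊ζ.im⌋ : ℤ) + 2 := by linarith [ht.1]
      exact ⟨by have : ⌊ζ.im⌋ - 2 < n := by exact_mod_cast h5
                exact this.le,
        by have : n < ⌊ζ.im⌋ + 2 := by exact_mod_cast h6
           exact this.le⟩
    · refine ⟨_, isClosed_frontier.isOpen_compl.mem_nhds hz, ?_⟩
      convert! finite_empty (α := ℤ)
      refine eq_empty_of_forall_notMem fun n ⟨w, hw, hwf⟩ => hwf ?_
      rw [← hunion]
      exact mem_iUnion.2 ⟨n, hw⟩

/-- The lift of the exponential function as a homeomorphism onto its image. -/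
noncomputable def homeomorph (h : IsLogLift f φ c M) (hinj : InjOn φ {ζ | c < ζ.re}) {x : ℝ} (hx : c < x) :
    (Complex.exp ⁻¹' {w | Real.exp x < ‖w‖} : Set ℂ) ≃ₜ φ '' {ζ | x < ζ.re} where
  toFun ζ := ⟨φ ζ, ζ, by
    have := ζ.2
    rwa [mem_preimage, mem_ofPred_eq, Complex.norm_exp, Real.exp_lt_exp] at this, rfl⟩
  invFun z := ⟨Function.invFunOn φ {ζ | x < ζ.re} z, by
    rw [mem_preimage, mem_ofPred_eq, Complex.norm_exp, Real.exp_lt_exp]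
    exact Function.invFunOn_mem z.2⟩
  left_inv ζ := Subtype.ext ((hinj.mono fun _ (hζ : x < _) => hx.trans hζ).leftInvOn_invFunOn (by
    have := ζ.2
    rwa [mem_preimage, mem_ofPred_eq, Complex.norm_exp, Real.exp_lt_exp] at this))
  right_inv z := Subtype.ext (Function.invFunOn_eq z.2)
  continuous_toFun := by
    refine Continuous.subtype_mk (h.continuousOn.comp_continuous continuous_subtype_val ?_) _
    intro ζ
    have := ζ.2
    rw [mem_preimage, mem_ofPred_eq, Complex.norm_exp, Real.exp_lt_exp] at this
    exact hx.trans this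
  continuous_invFun := by
    refine Continuous.subtype_mk ?_ _
    have hsub : {ζ : ℂ | x < ζ.re} ⊆ {ζ | c < ζ.re} := fun ζ hζ => hx.trans hζ
    rw [continuous_iff_continuousAt]
    rintro ⟨_, ζ, hζ, rfl⟩
    exact ContinuousAt.comp (g := Function.invFunOn φ {ζ | x < ζ.re}) (f := Subtype.val)
      (hasDerivAt_invFunOn (isOpen_lt_re x) (h.differentiableOn.mono hsub) (hinj.mono hsub)
        hζ).continuousAt continuous_subtype_val.continuousAt

/-- Through `homeomorph`, `f` on the image becomes `exp` on a half-plane, which gives the universal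
covering. The complement is unbounded because `f` takes small values arbitrarily far out. -/
theorem isLogarithmicTract (h : IsLogLift f φ c M) (ht : IsTranscendental f)
    (hinj : InjOn φ {ζ | c < ζ.re}) {x : ℝ} (hx : c < x) :
    IsLogarithmicTract f (φ '' {ζ | x < ζ.re}) := by
  have hnorm : ∀ ζ : ℂ, c < ζ.re → ‖f (φ ζ)‖ = Real.exp ζ.re := fun ζ hζ => by
    rw [h.apply_eq_exp ζ hζ, Complex.norm_exp]
  have hana : ∀ z ∈ closure (φ '' {ζ | x < ζ.re}), AnalyticAt ℂ f z := fun z hz => by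
    obtain ⟨ζ, hζ, rfl⟩ := h.closure_image_subset hx hz
    exact h.analyticAt (h.lt_norm ζ (hx.trans_le hζ)).le
  refine ⟨h.isOpen_image (isOpen_lt_re x) fun ζ hζ => hx.trans hζ, ⟨?_, ?_⟩, ?_, ?_,
    h.hasPiecewiseSmoothBoundary hinj hx,
    fun z hz => (hana z hz).continuousAt.continuousWithinAt, Real.exp x, Real.exp_pos x, ?_, ?_,
    ?_, ?_⟩
  · exact ⟨_, ((x + 1 : ℝ) : ℂ), by simp, rfl⟩
  · exact (convex_halfSpace_re_gt x).isPreconnected.image _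
      (h.continuousOn.mono fun ζ hζ => hx.trans hζ)
  · intro hb
    obtain ⟨B, hB⟩ := hb.exists_norm_le
    obtain ⟨X, hX⟩ := h.exists_forall_lt_norm B
    set y : ℝ := max x X + 1
    have h1 : x < y := (le_max_left x X).trans_lt (lt_add_one _)
    have h2 : X < y := (le_max_right x X).trans_lt (lt_add_one _)
    have h3 := hX y (by rw [Complex.ofReal_re]; linarith) (by simpa using h2)
    exact absurd (hB _ ⟨(y : ℂ), by simpa using h1, rfl⟩) (not_le.2 h3)
  · intro hb
    obtain ⟨B, hB⟩ := hb.exists_norm_le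
    obtain ⟨z, hz, hfz⟩ := ht.exists_norm_lt h.meromorphic h.finite_poles (Real.exp_pos x) B
    have hzT : z ∈ φ '' {ζ | x < ζ.re} := by
      by_contra hzT
      exact absurd (hB z hzT) (not_le.2 hz)
    obtain ⟨ζ, hζ, rfl⟩ := hzT
    rw [hnorm ζ (hx.trans hζ), Real.exp_lt_exp] at hfz
    exact lt_asymm hfz hζ
  · intro z hz
    rw [h.frontier_image hinj hx] at hz
    obtain ⟨ζ, hζ, rfl⟩ := hz
    have hζ' : ζ.re = x := hζ
    rw [hnorm ζ (by rwa [hζ']), hζ']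
  · exact fun z hz => (hana z (subset_closure hz)).differentiableAt.differentiableWithinAt
  · have : ContractibleSpace (Complex.exp ⁻¹' {w | Real.exp x < ‖w‖} : Set ℂ) := by
      have hset : Complex.exp ⁻¹' {w | Real.exp x < ‖w‖} = {ζ : ℂ | x < ζ.re} := by
        ext ζ
        rw [mem_preimage, mem_ofPred_eq, Complex.norm_exp, Real.exp_lt_exp, mem_ofPred_eq]
      rw [hset]
      exact (convex_halfSpace_re_gt x).contractibleSpace ⟨((x + 1 : ℝ) : ℂ), by simp⟩
    have := (h.homeomorph hinj hx).symm.contractibleSpace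
    infer_instance
  · have hmaps : MapsTo f (φ '' {ζ | x < ζ.re}) {w | Real.exp x < ‖w‖} := by
      rintro _ ⟨ζ, hζ, rfl⟩
      rw [mem_ofPred_eq, hnorm ζ (hx.trans hζ)]
      exact Real.exp_lt_exp.2 hζ
    refine ⟨hmaps, ?_⟩
    have hcov := (Complex.isCoveringMapOn_exp.mono (t := {w | Real.exp x < ‖w‖}) fun w hw =>
      norm_pos_iff.1 ((Real.exp_pos x).trans hw)).isCoveringMap_restrictPreimage
    refine (IsCoveringMap.comp_homeomorph_iff (h.homeomorph hinj hx)).1 ?_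
    convert! hcov using 1
    ext ζ
    have hζ := ζ.2
    rw [mem_preimage, mem_ofPred_eq, Complex.norm_exp, Real.exp_lt_exp] at hζ
    exact h.apply_eq_exp ζ (hx.trans hζ)

end IsLogLift

theorem hasLogarithmicTract_of_isClassB {f : ℂ → ℂ} (hf : MeromorphicNFOn f univ)
    (ht : IsTranscendental f) (hfin : (poles f).Finite) (hB : IsClassB f) :
    HasLogarithmicTract f := by
  obtain ⟨φ, c, M, hM, h⟩ := exists_isLogLift hf ht hfin hB
  exact ⟨_, h.isLogarithmicTract ht (h.injOn ht hM) (lt_add_one c)⟩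

end MeromorphicDynamics

theorem mainTheorem1 (f : ℂ → ℂ) (hf : MeromorphicNFOn f Set.univ) :
    (MeromorphicDynamics.IsTranscendental f → (MeromorphicDynamics.poles f).Finite →
      MeromorphicDynamics.IsClassB f → MeromorphicDynamics.HasLogarithmicTract f) ∧
    (MeromorphicDynamics.HasLogarithmicTract f →
      (∃ X : Set ℂ, MeromorphicDynamics.IsExpandingCantorRepeller f X ∧ 1 < dimH X) ∧
      1 < MeromorphicDynamics.hyperbolicDimension f ∧
      1 < dimH (MeromorphicDynamics.boundedOrbitJuliaSet f)) := by
  refine ⟨fun ht hfin hB => MeromorphicDynamics.hasLogarithmicTract_of_isClassB hf ht hfin hB, ?_⟩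
  rintro ⟨T, hT⟩
  obtain ⟨X, hX, hdim⟩ := hT.exists_repeller hf
  refine ⟨⟨X, hX, hdim⟩, hdim.trans_le ?_,
    hdim.trans_le (dimH_mono (MeromorphicDynamics.subset_boundedOrbitJuliaSet hX))⟩
  exact le_iSup₂_of_le (f := fun (X : Set ℂ)
    (_ : MeromorphicDynamics.IsExpandingCantorRepeller f X) => dimH X) X hX le_rfl
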